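/- **Setting.** Let $\theta>0$ and $q\in\{0,1,2,\dots\}$. Let $\mathcal H=\ell^2(\mathbb N_0)$ with number basis $e_n$, let $a e_n=\sqrt n\,e_{n-1}$, $a^\dagger e_n=\sqrt{n+1}\,e_{n+1}$ (on their maximal domains), $c=a/\sqrt{2\theta}$, $c^\dagger=a^\dagger/\sqrt{2\theta}$ (so $[c,c^\dagger]=\frac1{2\theta}$), let $S e_n=e_{n+1}$ be the shift and $P_{(q)}=\sum_{i<q}e_i\otimes e_i^*$. Write $\operatorname{Tr}=2\pi\theta\operatorname{tr}$ for the noncommutative integral, $\operatorname{tr}$ being the operator trace. A *field* is a pair $(D,\overline D)$ with $D$ a densely defined closed operator on $\mathcal H$ and $\overline D=-D^\dagger$. It has *curvature* $F$, a bounded operator, if $\overline DD$ and $D\overline D$ have the same natural domain and there $F=2i\big([\overline D,D]+\frac1{2\theta}\big)$. A *$q$-fluxon* is a field with a curvature $F$ that solves the Yang–Mills equations $[D,F]=[\overline D,F]=0$ (that is, $FD\subseteq DF$ and $F\overline D\subseteq\overline DF$; equivalently $[D,[\overline D,D]]=[\overline D,[\overline D,D]]=0$), that has finite action $\mathrm{YM}=-\frac14\operatorname{Tr}\sum_{i,j=1}^2F_{ij}^2$,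 where $F_{12}=-F_{21}=F$, $F_{11}=F_{22}=0$ (that is, $F^2$ is trace class), and that has topological charge $c_1=\frac1{2\pi i}\operatorname{Tr}F=q$. It has *rank one* if $\ker F\neq0$ and the representation given by $D,\overline D$ on $\ker F$ is irreducible (no nontrivial closed subspace of $\ker F$ reduces both operators). Gauge transformations are $(D,\overline D)\mapsto(UDU^{-1},U\overline DU^{-1})$ with $U$ unitary. **Theorem.** 1. For every $\lambda=(\lambda_0,\dots,\lambda_{q-1})\in\mathbb C^q$, $$D_\lambda=\sum_{i=0}^{q-1}\lambda_i\,e_i\otimes e_i^*-S^q\,c^\dagger\,(S^\dagger)^q,\qquad \overline D_\lambda=-D_\lambda^\dagger=-\sum_{i=0}^{q-1}\overline{\lambda_i}\,e_i\otimes e_i^*+S^q\,c\,(S^\dagger)^q$$ is a rank-one $q$-fluxon with curvature $F=\frac i\theta P_{(q)}$, for which $e_0,\dots,e_{q-1}$ is an orthonormal basis of the image of $F$ consisting of eigenvectors of $D_\lambda$; $-\operatorname{Tr}(F^2)=2\pi q/\theta$, and so the action is $\mathrm{YM}=-\frac12\operatorname{Tr}(F^2)=\pi q/\theta$. 2. The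 map $\lambda\mapsto(D_\lambda,\overline D_\lambda)$ is injective, and $(D_\lambda,\overline D_\lambda)$, $(D_\mu,\overline D_\mu)$ are gauge equivalent if and only if $\mu$ is a permutation of $\lambda$. 3. For every rank-one $q$-fluxon $(D,\overline D)$ with curvature $F$, the image of $F$ has an ordered orthonormal basis $(u_0,\dots,u_{q-1})$ of eigenvectors of $D$ (a labelling of the vortices), and for each such labelling there is exactly one $\lambda\in\mathbb C^q$ for which some unitary $U$ has $Ue_i=u_i$ for all $i<q$, $D=UD_\lambda U^{-1}$ and $\overline D=U\overline D_\lambda U^{-1}$. Hence rank-one $q$-fluxons with labelled vortices correspond, up to gauge transformations, bijectively to tuples $\lambda\in\mathbb C^q$, and unlabelled ones to tuples up to permutation. 4. Every $q$-fluxon, of whatever rank, with curvature $F$ has action $\pi q/\theta$, and there are a tuple $\lambda\in\mathbb C^q$, orthonormal vectors $u_0,\dots,u_{q-1}$ and a nonempty family of isometries $W_k:\mathcal H\to\mathcal H$, with ranges orthogonal to one another and to all $u_i$, such that the $u_i$ and these ranges together span a dense subspace, $F=\frac i\theta\sum_iu_i\otimes u_i^*$, $Du_i=\lambda_iu_i$,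 $\overline Du_i=-\overline{\lambda_i}u_i$, $DW_k=-W_kc^\dagger$ and $\overline DW_k=W_kc$ (as operators, including domains). -/

import Mathlib

open scoped InnerProductSpace ComplexConjugate

noncomputable section

namespace MoyalPlane

/-! ### Fock space and possibly unbounded operators on it -/

/-- The Fock space `ℓ²(ℕ₀)`. -/
abbrev Fock : Type := lp (fun _ : ℕ => ℂ) 2

/-- Possibly unbounded operators on Fock space: linear maps defined on a linear subspace. -/
abbrev Op : Type := Fock →ₗ.[ℂ] Fock

/-- Bounded operators on Fock space. -/
abbrev BOp : Type := Fock →L[ℂ] Fock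

/-- The number basis `e_n`. -/
def e (n : ℕ) : Fock := lp.single 2 n (1 : ℂ)

/-- A bounded operator, regarded as an operator with domain the whole space. -/
def ofBounded (T : BOp) : Op := (T : Fock →ₗ[ℂ] Fock).toPMap ⊤

/-- The product `A B` of unbounded operators, with its natural domain
`{v ∈ dom B | B v ∈ dom A}`. -/
def opMul (A B : Op) : Op where
  domain := (A.domain.comap B.toFun).map B.domain.subtype
  toFun :=
    { toFun := fun v => A ⟨B ⟨v.1, by
          obtain ⟨w, -, hw⟩ := v.2
          exact hw ▸ w.2⟩, by
          obtain ⟨v, w, hw, rfl⟩ := v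
          exact hw⟩
      map_add' := by
        intro v w
        rw [← A.map_add]
        congr 1
        apply Subtype.ext
        exact B.map_add ⟨v.1, _⟩ ⟨w.1, _⟩
      map_smul' := by
        intro r v
        rw [RingHom.id_apply, ← A.map_smul]
        congr 1
        apply Subtype.ext
        exact B.map_smul r ⟨v.1, _⟩ }

theorem mem_opMul_domain {A B : Op} {v : Fock} :
    v ∈ (opMul A B).domain ↔ ∃ h : v ∈ B.domain, B ⟨v, h⟩ ∈ A.domain := by
  constructor
  · rintro ⟨w, hw, rfl⟩
    exact ⟨w.2, hw⟩
  · rintro ⟨h, h'⟩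
    exact ⟨⟨v, h⟩, h', rfl⟩

/-- The operator on Fock space given by a linear operation on sequences, on its maximal domain:
all square-summable sequences that are mapped to square-summable ones. -/
def maximalOp (φ : (ℕ → ℂ) →ₗ[ℂ] (ℕ → ℂ)) : Op where
  domain :=
    { carrier := {v | Memℓp (φ (v : ℕ → ℂ)) 2}
      add_mem' := by
        intro v w hv hw
        have h : φ ((v + w : Fock) : ℕ → ℂ) = φ v + φ w := by
          rw [← map_add]; rfl
        simp only [Set.mem_ofPred_eq, h]
        exact hv.add hw
      zero_mem' := by
        have h : φ ((0 : Fock) : ℕ → ℂ) = 0 := by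
          rw [← map_zero φ]; rfl
        simp only [Set.mem_ofPred_eq, h]
        exact zero_memℓp
      smul_mem' := by
        intro r v hv
        have h : φ ((r • v : Fock) : ℕ → ℂ) = r • φ v := by
          rw [← map_smul]; rfl
        simp only [Set.mem_ofPred_eq, h]
        exact hv.const_smul r }
  toFun :=
    { toFun := fun v => ⟨φ (v.1 : ℕ → ℂ), v.2⟩
      map_add' := by
        intro v w
        apply Subtype.ext
        exact map_add φ (v.1 : ℕ → ℂ) (w.1 : ℕ → ℂ)
      map_smul' := by
        intro r v
        apply Subtype.ext
        exact map_smul φ r (v.1 : ℕ → ℂ) }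

/-- The annihilation operator: `a e_n = √n e_{n-1}`, that is `(a v)_n = √(n+1) v_{n+1}`. -/
def annihilation : Op :=
  maximalOp
    { toFun := fun v n => (Real.sqrt (n + 1) : ℂ) * v (n + 1)
      map_add' := by intro v w; funext n; simp [mul_add]
      map_smul' := by intro r v; funext n; simp [mul_left_comm] }

/-- The creation operator: `a† e_n = √(n+1) e_{n+1}`, that is `(a† v)_n = √n v_{n-1}`. -/
def creation : Op :=
  maximalOp
    { toFun := fun v n => (Real.sqrt n : ℂ) * v (n - 1)
      map_add' := by intro v w; funext n; simp [mul_add]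
      map_smul' := by intro r v; funext n; simp [mul_left_comm] }

/-- `c = a / √(2θ)`, the irreducible representation of `[c, c†] = 1/(2θ)`. -/
def c (θ : ℝ) : Op := ((1 / Real.sqrt (2 * θ) : ℝ) : ℂ) • annihilation

/-- `c† = a† / √(2θ)`. -/
def cDag (θ : ℝ) : Op := ((1 / Real.sqrt (2 * θ) : ℝ) : ℂ) • creation

theorem orthonormal_e : Orthonormal ℂ e := by
  classical
  rw [orthonormal_iff_ite]
  intro i j
  simp only [e, lp.inner_single_left, lp.single_apply]
  by_cases h : i = j
  · subst h; simp
  · simp [h]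

/-- The shift operator, the isometry with `S e_n = e_{n+1}`. -/
def shift : Fock →ₗᵢ[ℂ] Fock :=
  (orthonormal_e.comp Nat.succ Nat.succ_injective).orthogonalFamily.linearIsometry

theorem shift_e (n : ℕ) : shift (e n) = e (n + 1) := by
  simp only [shift, e, OrthogonalFamily.linearIsometry_apply_single]
  simp [e]

/-- The shift as a bounded operator. -/
def S : BOp := shift.toContinuousLinearMap

/-! ### Yang-Mills theory on the Moyal plane -/

/-- `T` commutes with the operator `D` (that is, `T D ⊆ D T`). -/
def Commutes (T : BOp) (D : Op) : Prop :=
  ∀ v : D.domain, ∃ h : T v ∈ D.domain, D ⟨T v, h⟩ = T (D v)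

/-- `T` is trace class with trace `t`: the sum of the diagonal matrix elements of `T` converges
(unconditionally) to `t` in every orthonormal basis. -/
def HasTrace (T : BOp) (t : ℂ) : Prop :=
  ∀ b : HilbertBasis ℕ ℂ Fock, HasSum (fun n => ⟪b n, T (b n)⟫_ℂ) t

/-- `T` has noncommutative integral `t`: the noncommutative integral, which under the Weyl
correspondence is integration over the plane, is `2πθ` times the operator trace. -/
def HasIntegral (θ : ℝ) (T : BOp) (t : ℂ) : Prop :=
  ∃ s : ℂ, HasTrace T s ∧ t = 2 * Real.pi * θ * s

/-- The bounded operator `F` is the curvature `F₁₂ = 2i ([D̄, D] + 1/(2θ))`. The operators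
`D̄ D` and `D D̄` are taken on their natural domains, which have to agree. -/
structure IsCurvature (θ : ℝ) (D Dbar : Op) (F : BOp) : Prop where
  domain_eq : (opMul Dbar D).domain = (opMul D Dbar).domain
  curvature_eq :
    (2 * Complex.I) • (opMul Dbar D - opMul D Dbar
      + ofBounded ((1 / (2 * θ) : ℂ) • ContinuousLinearMap.id ℂ Fock)) ≤ ofBounded F

/-- The components `F_{ij}` of the field strength, with `F₁₂ = F`. -/
def fieldStrength (F : BOp) : Matrix (Fin 2) (Fin 2) BOp := !![0, F; -F, 0]

/-- The Yang-Mills functional `-(1/4) Tr ∑_{i,j} (F_{ij})²` of a field with curvature `F` is well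
defined and equal to `s`. -/
def HasYMAction (θ : ℝ) (F : BOp) (s : ℝ) : Prop :=
  HasIntegral θ (-(1 / 4 : ℂ) • ∑ i, ∑ j, fieldStrength F i j * fieldStrength F i j) s

/-- The pair `D, D̄` is a `q`-fluxon with curvature `F`: an anti-Hermitean finite-action solution
of the Yang-Mills equations of topological charge `q`. -/
structure IsFluxonWithCurvature (θ : ℝ) (q : ℕ) (D Dbar : Op) (F : BOp) : Prop where
  dense_domain : Dense (D.domain : Set Fock)
  closed : D.IsClosed
  /-- `D₁ = D + D̄` and `D₂ = i (D - D̄)` are anti-Hermitean. -/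
  antiHermitean : Dbar = -D.adjoint
  isCurvature : IsCurvature θ D Dbar F
  /-- The Yang-Mills equations `[D, F] = [D̄, F] = 0`; as `F` is `2i [D̄, D]` up to a
  multiple of the identity, these are `[D, [D̄, D]] = [D̄, [D̄, D]] = 0`. -/
  yangMills : Commutes F D
  yangMills_bar : Commutes F Dbar
  finite_action : ∃ s : ℝ, HasYMAction θ F s
  /-- The first Chern number is `(1/(2πi)) Tr F`. -/
  charge : HasIntegral θ ((1 / (2 * Real.pi * Complex.I)) • F) q

/-- The pair `D, D̄` is a `q`-fluxon. -/
def IsFluxon (θ : ℝ) (q : ℕ) (D Dbar : Op) : Prop :=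
  ∃ F : BOp, IsFluxonWithCurvature θ q D Dbar F

/-- The closed subspace `M` reduces the operator `D`: the orthogonal projection onto `M` commutes
with `D`. -/
def Reduces (M : ClosedSubmodule ℂ Fock) (D : Op) : Prop :=
  Commutes M.toSubmodule.starProjection D

/-- A field with curvature `F` has rank one: on the orthogonal complement `ker F` of the image of
the (normal) operator `F`, the representation given by `D` and `D̄` is irreducible. -/
def IsRankOne (D Dbar : Op) (F : BOp) : Prop :=
  F.ker ≠ ⊥ ∧ ∀ M : ClosedSubmodule ℂ Fock, M.toSubmodule ≤ F.ker →
    Reduces M D → Reduces M Dbar → M.toSubmodule = ⊥ ∨ M.toSubmodule = F.ker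

/-- Conjugation `U A U⁻¹` of an operator by a unitary (a gauge transformation). -/
def conjOp (U : Fock ≃ₗᵢ[ℂ] Fock) (A : Op) : Op :=
  opMul (ofBounded U.toContinuousLinearEquiv)
    (opMul A (ofBounded U.symm.toContinuousLinearEquiv))

/-- Gauge equivalence of pairs `(D, D̄)`. -/
def GaugeEquiv (D Dbar D' Dbar' : Op) : Prop :=
  ∃ U : Fock ≃ₗᵢ[ℂ] Fock, D' = conjOp U D ∧ Dbar' = conjOp U Dbar

/-- A labelling of the vortices: an ordered orthonormal basis `u` of the image of the
curvature `F` that consists of eigenvectors of `D`. -/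
structure IsVortexFrame {q : ℕ} (D : Op) (F : BOp) (u : Fin q → Fock) : Prop where
  orthonormal : Orthonormal ℂ u
  span_eq : Submodule.span ℂ (Set.range u) = F.range
  eigenvector : ∀ i, ∃ (h : u i ∈ D.domain) (l : ℂ), D ⟨u i, h⟩ = l • u i

/-- The rank one operator `u ⊗ u*`. -/
def proj (u : Fock) : BOp := InnerProductSpace.rankOne ℂ u u

/-- `P_(q) = ∑_{i<q} e_i ⊗ e_i*`. -/
def P (q : ℕ) : BOp := ∑ i : Fin q, proj (e i)

/-- `D = ∑_{i<q} λ_i e_i ⊗ e_i* - S^q c† S†^q`. -/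
def fluxonD (θ : ℝ) {q : ℕ} (l : Fin q → ℂ) : Op :=
  ofBounded (∑ i, l i • proj (e i))
    - opMul (ofBounded (S ^ q)) (opMul (cDag θ) (ofBounded (S.adjoint ^ q)))

/-- `D̄ = -∑_{i<q} conj(λ_i) e_i ⊗ e_i* + S^q c S†^q`. -/
def fluxonDbar (θ : ℝ) {q : ℕ} (l : Fin q → ℂ) : Op :=
  -ofBounded (∑ i, conj (l i) • proj (e i))
    + opMul (ofBounded (S ^ q)) (opMul (c θ) (ofBounded (S.adjoint ^ q)))

end MoyalPlane

end

noncomputable section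

namespace MoyalPlane

/-! ### Pairs of mutually adjoint closed operators, described by their graphs -/

section AdjointPair

variable {E : Type*} [NormedAddCommGroup E] [InnerProductSpace ℂ E]

/-! Put A = D† = -D̄, κ = 1/(2θ) and G = -iθF. The curvature equation becomes AD = DA + κ(1 - G),
with equal domains on both sides, and the Yang-Mills equations say that G commutes with D and A
(`IsLadderPair`). Since AD and DA are symmetric, G is self-adjoint. Finite action then makes G
Hilbert-Schmidt, hence compact.

On the finite-dimensional eigenspace of G for an eigenvalue g ≠ 0, D and A are matrices with
commutator κ(1 - g). The trace of a commutator vanishes, so g = 1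
(`IsLadderPair.eigenvalue_eq_one`). Thus G is a finite-rank projection, of rank q by the topological
charge. On its image D commutes with its adjoint, so it is unitarily diagonalizable; this gives the
vortices and the λ_i (`IsFluxonWithCurvature.exists_vortices`).

On ker G the relation is AD - DA = κ, and each unit vector killed by A generates a ladder, a copy of
the Fock representation. The ladders over an orthonormal basis of vacua are complete: on the part of
ker G orthogonal to all of them, ‖Av‖² ≥ nκ‖v‖² for every n (`IsLadderPair.mul_sq_norm_le`), which
forces this part to be zero. Rank one leaves a single ladder; together with the labelled vortices it
is the image of the number basis under the required unitary.

Domains are controlled by working with graphs. The standard operators are weighted shifts on maximal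
domains, and an isometry that intertwines such a shift and its adjoint with another adjoint pair on
basis vectors does so including domains (`IsTransposed.mem_graph_isometry_iff`). For gauge
equivalence of D_λ and D_μ, the unitary preserves the curvature and so restricts to an invertible q
× q matrix, whose nonzero entries can only link equal eigenvalues. A nonvanishing term of its
determinant is the permutation. -/

theorem graph_smul_mem {X : E →ₗ.[ℂ] E} {x x' : E} (a : ℂ) (h : (x, x') ∈ X.graph) :
    (a • x, a • x') ∈ X.graph :=
  X.graph.smul_mem a h

theorem graph_add_mem {X : E →ₗ.[ℂ] E} {x x' y y' : E} (h : (x, x') ∈ X.graph)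
    (h' : (y, y') ∈ X.graph) : (x + y, x' + y') ∈ X.graph :=
  X.graph.add_mem h h'

theorem graph_sub_mem {X : E →ₗ.[ℂ] E} {x x' y y' : E} (h : (x, x') ∈ X.graph)
    (h' : (y, y') ∈ X.graph) : (x - y, x' - y') ∈ X.graph :=
  X.graph.sub_mem h h'

theorem graph_unique {X : E →ₗ.[ℂ] E} {x y z : E} (h : (x, y) ∈ X.graph) (h' : (x, z) ∈ X.graph) :
    y = z :=
  X.mem_graph_snd_inj h h' rfl

theorem mem_graph_iff_exists {X : E →ₗ.[ℂ] E} {x y : E} :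
    (x, y) ∈ X.graph ↔ ∃ h : x ∈ X.domain, X ⟨x, h⟩ = y := by
  simp [LinearPMap.mem_graph_iff]

/-- Each of the two operators is the adjoint of the other one. -/
structure IsAdjointPair (X Y : E →ₗ.[ℂ] E) : Prop where
  mem_right : ∀ y y', (y, y') ∈ Y.graph ↔ ∀ x x', (x, x') ∈ X.graph → ⟪x', y⟫_ℂ = ⟪x, y'⟫_ℂ
  mem_left : ∀ x x', (x, x') ∈ X.graph ↔ ∀ y y', (y, y') ∈ Y.graph → ⟪x', y⟫_ℂ = ⟪x, y'⟫_ℂ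

namespace IsAdjointPair

variable {X Y : E →ₗ.[ℂ] E}

theorem inner_eq (h : IsAdjointPair X Y) {x x' y y' : E} (hx : (x, x') ∈ X.graph)
    (hy : (y, y') ∈ Y.graph) : ⟪x', y⟫_ℂ = ⟪x, y'⟫_ℂ :=
  (h.mem_right y y').1 hy x x' hx

theorem symm (h : IsAdjointPair X Y) : IsAdjointPair Y X where
  mem_right x x' := by
    rw [h.mem_left]
    refine forall₂_congr fun y y' => imp_congr_right fun _ => ?_
    rw [← inner_conj_symm x' y, ← inner_conj_symm x y', (starRingEnd ℂ).injective.eq_iff, eq_comm]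
  mem_left y y' := by
    rw [h.mem_right]
    refine forall₂_congr fun x x' => imp_congr_right fun _ => ?_
    rw [← inner_conj_symm x' y, ← inner_conj_symm x y', (starRingEnd ℂ).injective.eq_iff, eq_comm]

theorem inner_eq' (h : IsAdjointPair X Y) {x x' y y' : E} (hx : (x, x') ∈ X.graph)
    (hy : (y, y') ∈ Y.graph) : ⟪y', x⟫_ℂ = ⟪y, x'⟫_ℂ :=
  h.symm.inner_eq hy hx

theorem isClosed_graph (h : IsAdjointPair X Y) : IsClosed (X.graph : Set (E × E)) := by
  have : (X.graph : Set (E × E)) =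
      ⋂ p ∈ Y.graph, {z : E × E | ⟪z.2, p.1⟫_ℂ = ⟪z.1, p.2⟫_ℂ} := by
    ext ⟨x, x'⟩
    simp only [SetLike.mem_coe, h.mem_left, Set.mem_iInter, Set.mem_ofPred_eq, Prod.forall]
  rw [this]
  exact isClosed_biInter fun p _ => isClosed_eq (by fun_prop) (by fun_prop)

variable [CompleteSpace E]

/-- This is X†† = X for closed X. In the Hilbert sum E ⊕ E, a vector (w₁, w₂) orthogonal to the
graph of X yields (w₂, -w₁) in the graph of X†, so the condition on (x, x') places it in the double
orthogonal complement of a closed subspace. -/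
theorem of_adjoint (hd : Dense (X.domain : Set E)) (hc : X.IsClosed) :
    IsAdjointPair X X.adjoint := by
  have hr : ∀ y y', (y, y') ∈ X.adjoint.graph ↔
      ∀ x x', (x, x') ∈ X.graph → ⟪x', y⟫_ℂ = ⟪x, y'⟫_ℂ := by
    intro y y'
    rw [LinearPMap.adjoint_graph_eq_graph_adjoint hd, Submodule.mem_adjoint_iff]
    simp only [sub_eq_zero]
  refine ⟨hr, fun x x' => ⟨fun hx y y' hy => (hr y y').1 hy x x' hx, fun H => ?_⟩⟩
  let K : Submodule ℂ (WithLp 2 (E × E)) :=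
    X.graph.comap (WithLp.linearEquiv 2 ℂ (E × E)).toLinearMap
  have hK : IsClosed (K : Set (WithLp 2 (E × E))) :=
    IsClosed.preimage (WithLp.prod_continuous_ofLp 2 E E) hc
  have : CompleteSpace K := hK.completeSpace_coe
  suffices WithLp.toLp 2 (x, x') ∈ Kᗮᗮ by
    rw [Submodule.orthogonal_orthogonal] at this
    exact this
  rw [Submodule.mem_orthogonal']
  intro w hw
  have h1 : (w.snd, -w.fst) ∈ X.adjoint.graph := by
    rw [hr]
    intro a b hab
    have := (Submodule.mem_orthogonal K w).1 hw (WithLp.toLp 2 (a, b)) hab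
    simp only [WithLp.prod_inner_apply, WithLp.ofLp_fst, WithLp.ofLp_snd] at this
    rw [inner_neg_right]
    linear_combination this
  have h2 := H _ _ h1
  simp only [WithLp.prod_inner_apply, WithLp.ofLp_fst, WithLp.ofLp_snd]
  rw [inner_neg_right] at h2
  linear_combination h2

/-- The range of `c + X† X` is everything, for `c > 0`. -/
theorem exists_resolvent (h : IsAdjointPair X Y) {c : ℝ} (hc : 0 < c) (v : E) :
    ∃ x y, (x, y) ∈ X.graph ∧ (y, v - (c : ℂ) • x) ∈ Y.graph := by
  set s : ℂ := (Real.sqrt c : ℂ) with hs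
  have hss : s * s = c := by rw [hs, ← Complex.ofReal_mul, Real.mul_self_sqrt hc.le]
  have hs0 : s ≠ 0 := by
    rw [hs]; exact_mod_cast (Real.sqrt_pos.2 hc).ne'
  have hsc : conj s = s := by rw [hs, Complex.conj_ofReal]
  -- Von Neumann's argument: K consists of the pairs (√c x, Xx). The projection of (v/√c, 0) to K
  -- has this form, and orthogonality of the remainder to K says that Y(Xx) = v - cx.
  let φ : WithLp 2 (E × E) →ₗ[ℂ] E × E :=
    { toFun := fun w => (s⁻¹ • w.fst, w.snd)
      map_add' := by intro a b; simp
      map_smul' := fun a b => Prod.ext (smul_comm _ _ _) rfl }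
  have hφ : Continuous φ := by
    change Continuous fun w : WithLp 2 (E × E) => (s⁻¹ • w.fst, w.snd)
    have := WithLp.prod_continuous_ofLp 2 E E
    exact ((continuous_fst.comp this).const_smul _).prodMk (continuous_snd.comp this)
  let K : Submodule ℂ (WithLp 2 (E × E)) := X.graph.comap φ
  have hK : IsClosed (K : Set (WithLp 2 (E × E))) := h.isClosed_graph.preimage hφ
  have : CompleteSpace K := hK.completeSpace_coe
  set w : WithLp 2 (E × E) := WithLp.toLp 2 (s⁻¹ • v, 0) with hw
  set p : WithLp 2 (E × E) := K.starProjection w with hp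
  have hpK : p ∈ K := K.starProjection_apply_mem w
  have hpo : w - p ∈ Kᗮ := K.sub_starProjection_mem_orthogonal w
  refine ⟨s⁻¹ • p.fst, p.snd, hpK, (h.mem_right _ _).2 fun a b hab => ?_⟩
  have := (Submodule.mem_orthogonal K _).1 hpo (WithLp.toLp 2 (s • a, b))
    (by simpa [K, φ, smul_smul, hs0] using hab)
  simp only [WithLp.prod_inner_apply, WithLp.ofLp_fst, WithLp.ofLp_snd, hw, inner_smul_left,
    inner_sub_right, inner_smul_right, hsc, inner_zero_right] at this
  simp only [inner_smul_right, inner_sub_right, ← hss]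
  have e1 : s * (s⁻¹ * ⟪a, v⟫_ℂ) = ⟪a, v⟫_ℂ := by field_simp
  have e2 : s * s * (s⁻¹ * ⟪a, p.fst⟫_ℂ) = s * ⟪a, p.fst⟫_ℂ := by field_simp
  rw [e2]
  linear_combination -this + e1

end IsAdjointPair

end AdjointPair

/-! ### Commutation relations and completeness of the ladders -/

section LadderPair

variable {E : Type*} [NormedAddCommGroup E] [InnerProductSpace ℂ E]

theorem inner_self_eq_ofReal_norm_sq (x : E) : ⟪x, x⟫_ℂ = ((‖x‖ ^ 2 : ℝ) : ℂ) := by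
  rw [inner_self_eq_norm_sq_to_K]; simp

namespace IsAdjointPair

variable {X Y : E →ₗ.[ℂ] E}

/-- Positivity of X†X: pairing with x gives ‖y‖² = -c‖x‖². -/
theorem eq_zero_of_neg_eigenvalue (h : IsAdjointPair X Y) {c : ℝ} (hc : 0 < c) {x y : E}
    (hx : (x, y) ∈ X.graph) (hy : (y, -((c : ℂ) • x)) ∈ Y.graph) : x = 0 := by
  have h1 := h.inner_eq hx hy
  rw [inner_neg_right, inner_smul_right, inner_self_eq_ofReal_norm_sq,
    inner_self_eq_ofReal_norm_sq] at h1
  have h2 : ‖y‖ ^ 2 = -(c * ‖x‖ ^ 2) := by exact_mod_cast h1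
  have h3 : ‖x‖ ^ 2 = 0 := by nlinarith [sq_nonneg ‖y‖, sq_nonneg ‖x‖]
  simpa using h3

/-- The domain of `X† X` is dense. -/
theorem eq_zero_of_inner_domain_eq_zero [CompleteSpace E] (h : IsAdjointPair X Y) {v : E}
    (hv : ∀ x y z, (x, y) ∈ X.graph → (y, z) ∈ Y.graph → ⟪x, v⟫_ℂ = 0) : v = 0 := by
  -- The vector x = (1 + X†X)⁻¹v lies in the domain, so it is orthogonal to v; but ⟪x, v⟫ = ‖x‖² +
  -- ‖y‖².
  obtain ⟨x, y, hx, hy⟩ := h.exists_resolvent one_pos v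
  have h0 := hv x y _ hx hy
  have h1 := h.inner_eq hx hy
  rw [inner_sub_right, h0, inner_smul_right, inner_self_eq_ofReal_norm_sq,
    inner_self_eq_ofReal_norm_sq] at h1
  have h2 : ‖y‖ ^ 2 = 0 - (1 : ℝ) * ‖x‖ ^ 2 := by exact_mod_cast h1
  have hx0 : ‖x‖ ^ 2 = 0 := by nlinarith [sq_nonneg ‖y‖, sq_nonneg ‖x‖]
  have hy0 : ‖y‖ ^ 2 = 0 := by nlinarith [sq_nonneg ‖y‖, sq_nonneg ‖x‖]
  have hx0 : x = 0 := by simpa using hx0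
  have hy0 : y = 0 := by simpa using hy0
  subst hx0 hy0
  exact graph_unique (by simpa using hy) (Y.graph.zero_mem)

end IsAdjointPair

/-- `A = D†` and `A D = D A + κ (1 - G)`, including domains, with `G` commuting with `D` and `A`. -/
structure IsLadderPair (κ : ℝ) (G : E →L[ℂ] E) (D A : E →ₗ.[ℂ] E) : Prop where
  pair : IsAdjointPair D A
  up : ∀ x y z, (x, y) ∈ D.graph → (y, z) ∈ A.graph →
    ∃ y', (x, y') ∈ A.graph ∧ (y', z - (κ : ℂ) • (x - G x)) ∈ D.graph
  down : ∀ x y z, (x, y) ∈ A.graph → (y, z) ∈ D.graph →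
    ∃ y', (x, y') ∈ D.graph ∧ (y', z + (κ : ℂ) • (x - G x)) ∈ A.graph
  comm : ∀ x y, (x, y) ∈ D.graph → (G x, G y) ∈ D.graph
  comm' : ∀ x y, (x, y) ∈ A.graph → (G x, G y) ∈ A.graph

namespace IsLadderPair

variable {κ : ℝ} {G : E →L[ℂ] E} {D A : E →ₗ.[ℂ] E}

/-- On the common domain of AD and DA both products are symmetric, hence so is their difference κ(1
- G). That domain is dense and G is bounded. -/
theorem isSelfAdjoint [CompleteSpace E] (h : IsLadderPair κ G D A) (hκ : 0 < κ) :
    IsSelfAdjoint G := by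
  have key : ∀ x y z x' y' z', (x, y) ∈ D.graph → (y, z) ∈ A.graph → (x', y') ∈ D.graph →
      (y', z') ∈ A.graph → ⟪G x, x'⟫_ℂ = ⟪x, G x'⟫_ℂ := by
    intro x y z x' y' z' hx hy hx' hy'
    obtain ⟨w, hw, hw2⟩ := h.up x y z hx hy
    obtain ⟨w', hw', hw2'⟩ := h.up x' y' z' hx' hy'
    have e1 := h.pair.inner_eq hw2 hw'
    have e2 := h.pair.inner_eq' hw2' hw
    have e3 := h.pair.inner_eq hx hy'
    have e4 := h.pair.inner_eq' hx' hy
    rw [inner_sub_left, inner_smul_left, inner_sub_left, Complex.conj_ofReal] at e1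
    have e2' : ⟪w, w'⟫_ℂ = ⟪x, z' - (κ : ℂ) • (x' - G x')⟫_ℂ := e2
    rw [inner_sub_right, inner_smul_right, inner_sub_right] at e2'
    have hk : (κ : ℂ) ≠ 0 := by exact_mod_cast hκ.ne'
    have : (κ : ℂ) * ⟪G x, x'⟫_ℂ = κ * ⟪x, G x'⟫_ℂ := by
      linear_combination e1 + e2' - e4 - e3
    exact mul_left_cancel₀ hk this
  -- Density enters twice: here it gives G†x = Gx for x in the domain, and below it extends this to
  -- every vector.
  have step : ∀ x y z, (x, y) ∈ D.graph → (y, z) ∈ A.graph → G.adjoint x = G x := by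
    intro x y z hx hy
    refine sub_eq_zero.1 (h.pair.eq_zero_of_inner_domain_eq_zero fun x' y' z' hx' hy' => ?_)
    rw [inner_sub_right, ContinuousLinearMap.adjoint_inner_right, key x' y' z' x y z hx' hy' hx hy,
      sub_self]
  rw [ContinuousLinearMap.isSelfAdjoint_iff']
  ext w
  refine sub_eq_zero.1 (h.pair.eq_zero_of_inner_domain_eq_zero fun x y z hx hy => ?_)
  rw [inner_sub_right, ContinuousLinearMap.adjoint_inner_right,
    ← ContinuousLinearMap.adjoint_inner_left, step x y z hx hy, sub_self]

section Vacuum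

variable {ι : Type*} {f : ι → ℕ → E} {r : ℕ → ℂ}

/-- The resolvent (κ + DA)⁻¹ preserves ker G: the vector Gx solves DA(Gx) = -κGx, which positivity
excludes unless Gx = 0. -/
theorem map_eq_zero_of_resolvent (h : IsLadderPair κ G D A) (hκ : 0 < κ) {v x y : E}
    (hG : G v = 0) (hx : (x, y) ∈ A.graph) (hy : (y, v - (κ : ℂ) • x) ∈ D.graph) : G x = 0 := by
  have h2 := h.comm _ _ hy
  rw [map_sub, hG, zero_sub, map_smul] at h2
  exact h.pair.symm.eq_zero_of_neg_eigenvalue hκ (h.comm' _ _ hx) h2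

/-- The states f k m are eigenvectors of DA with nonnegative eigenvalues, namely 0 for m = 0 and
|r_{m-1}|² otherwise, so (κ + DA)⁻¹ preserves their orthogonal complement. -/
theorem inner_eq_zero_of_resolvent (h : IsLadderPair κ G D A) (hκ : 0 < κ)
    (hD : ∀ k n, (f k n, r n • f k (n + 1)) ∈ D.graph)
    (hA : ∀ k n, (f k (n + 1), conj (r n) • f k n) ∈ A.graph)
    (hA0 : ∀ k, (f k 0, 0) ∈ A.graph) {v x y : E} (hv : ∀ k m, ⟪f k m, v⟫_ℂ = 0)
    (hx : (x, y) ∈ A.graph) (hy : (y, v - (κ : ℂ) • x) ∈ D.graph) (k : ι) (m : ℕ) :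
    ⟪f k m, x⟫_ℂ = 0 := by
  cases m with
  | zero =>
    have e := h.pair.symm.inner_eq (hA0 k) hy
    rw [inner_zero_left, inner_sub_right, hv, inner_smul_right] at e
    have hk : (κ : ℂ) ≠ 0 := by exact_mod_cast hκ.ne'
    have e' : (κ : ℂ) * ⟪f k 0, x⟫_ℂ = 0 := by linear_combination e
    exact (mul_eq_zero.1 e').resolve_left hk
  | succ m =>
    have e := h.pair.symm.inner_eq (hA k m) hy
    have e2 := h.pair.inner_eq (hD k m) hx
    rw [inner_smul_left] at e e2
    rw [inner_sub_right, hv, inner_smul_right, Complex.conj_conj, ← e2] at e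
    have hk : (κ + ‖r m‖ ^ 2 : ℂ) ≠ 0 := by
      have : κ + ‖r m‖ ^ 2 ≠ 0 := by positivity
      exact_mod_cast this
    have hr : r m * conj (r m) = (‖r m‖ : ℂ) ^ 2 := Complex.mul_conj' _
    have e' : (κ + ‖r m‖ ^ 2 : ℂ) * ⟪f k (m + 1), x⟫_ℂ = 0 := by
      rw [← hr]; linear_combination e
    exact (mul_eq_zero.1 e').resolve_left hk

variable [CompleteSpace E]

/-- On the part of ker G orthogonal to the ladders A has no kernel, and there the spectrum of DA
repeats with spacing κ. Hence a lower bound nκ for DA improves itself to (n + 1)κ; only quadratic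
forms and one resolvent are needed, no spectral theorem. -/
theorem mul_sq_norm_le (h : IsLadderPair κ G D A) (hκ : 0 < κ)
    (hD : ∀ k n, (f k n, r n • f k (n + 1)) ∈ D.graph)
    (hA : ∀ k n, (f k (n + 1), conj (r n) • f k n) ∈ A.graph)
    (hA0 : ∀ k, (f k 0, 0) ∈ A.graph)
    (hvac : ∀ w, G w = 0 → (w, 0) ∈ A.graph → (∀ k, ⟪f k 0, w⟫_ℂ = 0) → w = 0) (n : ℕ) :
    ∀ v v', G v = 0 → (∀ k m, ⟪f k m, v⟫_ℂ = 0) → (v, v') ∈ A.graph →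
      n * κ * ‖v‖ ^ 2 ≤ ‖v'‖ ^ 2 := by
  induction n with
  | zero => intro v v' _ _ _; simp only [Nat.cast_zero, zero_mul]; positivity
  | succ n ih =>
    intro v v' hG hv hvv
    -- Take x = (κ + DA)⁻¹Av. On ker G, AD = κ + DA, so A(Dx) = Av; then Dx - v is a vacuum
    -- orthogonal to the given ones, and v = Dx.
    obtain ⟨x, y, hx, hy⟩ := h.pair.symm.exists_resolvent hκ v'
    have hGv' : G v' = 0 := by
      have := h.comm' _ _ hvv
      rw [hG] at this
      exact graph_unique this A.graph.zero_mem
    have hfv' : ∀ k m, ⟪f k m, v'⟫_ℂ = 0 := by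
      intro k m
      rw [← h.pair.inner_eq (hD k m) hvv, inner_smul_left, hv, mul_zero]
    have hGx := h.map_eq_zero_of_resolvent hκ hGv' hx hy
    have hfx := h.inner_eq_zero_of_resolvent hκ hD hA hA0 hfv' hx hy
    obtain ⟨y', hy1, hy2⟩ := h.down _ _ _ hx hy
    rw [hGx, sub_zero, sub_add_cancel] at hy2
    have hw : y' - v = 0 := by
      refine hvac _ ?_ ?_ fun k => ?_
      · have := h.comm _ _ hy1
        rw [hGx] at this
        rw [map_sub, hG, sub_zero]
        exact graph_unique this D.graph.zero_mem
      · simpa using graph_sub_mem hy2 hvv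
      · rw [inner_sub_right, hv, ← h.pair.symm.inner_eq (hA0 k) hy1, inner_zero_left, sub_zero]
    have hyv : y' = v := sub_eq_zero.1 hw
    subst hyv
    have i1 := ih x y hGx hfx hx
    have e1 := h.pair.inner_eq hy1 hy2
    have e2 := h.pair.symm.inner_eq hx hy
    rw [inner_sub_right, ← e1, inner_smul_right, inner_self_eq_ofReal_norm_sq,
      inner_self_eq_ofReal_norm_sq, inner_self_eq_ofReal_norm_sq] at e2
    have e3 : ‖y‖ ^ 2 = ‖y'‖ ^ 2 - κ * ‖x‖ ^ 2 := by exact_mod_cast e2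
    have e4 : ‖y'‖ ^ 2 ≤ ‖x‖ * ‖v'‖ := by
      have := norm_inner_le_norm (𝕜 := ℂ) x v'
      rw [← e1, inner_self_eq_ofReal_norm_sq] at this
      simpa using this
    rcases eq_or_ne y' 0 with h0 | h0
    · rw [h0, norm_zero]; simp only [ne_eq, OfNat.ofNat_ne_zero, not_false_eq_true, zero_pow,
        mul_zero]; positivity
    · have hpos : 0 < ‖y'‖ ^ 2 := by positivity
      -- The induction hypothesis for x and ‖Ax‖² = ‖v‖² - κ‖x‖² give (n + 1)κ‖x‖² ≤ ‖v‖². Combined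
      -- with ‖v‖² = ⟪x, Av⟫ ≤ ‖x‖‖Av‖ this is the bound for v after division by ‖v‖².
      have e5 : (n + 1) * κ * ‖x‖ ^ 2 ≤ ‖y'‖ ^ 2 := by linarith
      have e6 : (‖y'‖ ^ 2) ^ 2 ≤ ‖x‖ ^ 2 * ‖v'‖ ^ 2 := by
        rw [← mul_pow]; exact pow_le_pow_left₀ hpos.le e4 2
      have hnk : 0 ≤ (n + 1) * κ := by positivity
      have e7 : ((n + 1) * κ * ‖y'‖ ^ 2) * ‖y'‖ ^ 2 ≤ ‖v'‖ ^ 2 * ‖y'‖ ^ 2 := by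
        have a1 := mul_le_mul_of_nonneg_left e6 hnk
        have a2 := mul_le_mul_of_nonneg_right e5 (sq_nonneg ‖v'‖)
        nlinarith
      push_cast
      exact le_of_mul_le_mul_right e7 hpos

/-- A vector in `ker G` that is orthogonal to the states obtained from a complete set of vacua
vanishes. -/
theorem eq_zero_of_orthogonal_ladders (h : IsLadderPair κ G D A) (hκ : 0 < κ)
    (hD : ∀ k n, (f k n, r n • f k (n + 1)) ∈ D.graph)
    (hA : ∀ k n, (f k (n + 1), conj (r n) • f k n) ∈ A.graph)
    (hA0 : ∀ k, (f k 0, 0) ∈ A.graph)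
    (hvac : ∀ w, G w = 0 → (w, 0) ∈ A.graph → (∀ k, ⟪f k 0, w⟫_ℂ = 0) → w = 0)
    {v : E} (hG : G v = 0) (hv : ∀ k n, ⟪f k n, v⟫_ℂ = 0) : v = 0 := by
  obtain ⟨x, y, hx, hy⟩ := h.pair.symm.exists_resolvent hκ v
  have hGx := h.map_eq_zero_of_resolvent hκ hG hx hy
  have hfx := h.inner_eq_zero_of_resolvent hκ hD hA hA0 hv hx hy
  have hx0 : x = 0 := by
    -- If x = (κ + DA)⁻¹v were nonzero, ‖Ax‖² would exceed every multiple of κ‖x‖².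
    by_contra h0
    have hpos : 0 < κ * ‖x‖ ^ 2 := by positivity
    obtain ⟨n, hn⟩ := exists_nat_gt (‖y‖ ^ 2 / (κ * ‖x‖ ^ 2))
    rw [div_lt_iff₀ hpos, ← mul_assoc] at hn
    exact hn.not_ge (h.mul_sq_norm_le hκ hD hA hA0 hvac n x y hGx hfx hx)
  subst hx0
  have hy0 := graph_unique hx A.graph.zero_mem
  subst hy0
  rw [smul_zero, sub_zero] at hy
  exact graph_unique hy D.graph.zero_mem

end Vacuum

end IsLadderPair

end LadderPair

/-! ### Compactness from square-summable columns -/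

section HilbertSchmidt

variable {E : Type*} [NormedAddCommGroup E] [InnerProductSpace ℂ E] [CompleteSpace E]

/-- Hilbert-Schmidt operators are compact. -/
theorem isCompactOperator_of_summable_norm_sq {ι : Type*} (b : HilbertBasis ι ℂ E) (T : E →L[ℂ] E)
    (hT : Summable fun n => ‖T (b n)‖ ^ 2) : IsCompactOperator T := by
  classical
  let R : Finset ι → E →L[ℂ] E := fun s => ∑ n ∈ s, InnerProductSpace.rankOne ℂ (T (b n)) (b n)
  have hR : ∀ s, IsCompactOperator (R s) := by
    intro s
    have : R s ∈ compactOperator (RingHom.id ℂ) E E := by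
      refine Submodule.sum_mem _ fun n _ => ?_
      change IsCompactOperator (InnerProductSpace.rankOne ℂ (T (b n)) (b n))
      have h1 : IsCompactOperator (innerSL ℂ (b n)) :=
        isCompactOperator_of_locallyCompactSpace_dom _
      exact h1.clm_comp (ContinuousLinearMap.toSpanSingleton ℂ (T (b n)))
    exact this
  have hRx : ∀ s x, R s x = ∑ n ∈ s, ⟪b n, x⟫_ℂ • T (b n) := by
    intro s x
    simp [R]
  have hTx : ∀ x, Filter.Tendsto (fun s => R s x) Filter.atTop (nhds (T x)) := by
    intro x
    have h1 := (b.hasSum_repr x).mapL T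
    have h2 : HasSum (fun n => ⟪b n, x⟫_ℂ • T (b n)) (T x) := by
      convert h1 using 2 with n
      rw [map_smul, b.repr_apply_apply]
    refine h2.congr fun s => ?_
    exact (hRx s x).symm
  -- The finite-rank truncations are Cauchy in operator norm, by Cauchy-Schwarz and Bessel's
  -- inequality; the pointwise limit T is then a norm limit.
  have hbound : ∀ s t : Finset ι, s ⊆ t → ∀ x,
      ‖R t x - R s x‖ ≤ Real.sqrt (∑ n ∈ t \ s, ‖T (b n)‖ ^ 2) * ‖x‖ := by
    intro s t hst x
    rw [hRx, hRx, ← Finset.sum_sdiff hst, add_sub_cancel_right]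
    calc ‖∑ n ∈ t \ s, ⟪b n, x⟫_ℂ • T (b n)‖
        ≤ ∑ n ∈ t \ s, ‖T (b n)‖ * ‖⟪b n, x⟫_ℂ‖ := by
          refine (norm_sum_le _ _).trans (Finset.sum_le_sum fun n _ => ?_)
          rw [norm_smul, mul_comm]
      _ ≤ Real.sqrt (∑ n ∈ t \ s, ‖T (b n)‖ ^ 2) *
            Real.sqrt (∑ n ∈ t \ s, ‖⟪b n, x⟫_ℂ‖ ^ 2) := Real.sum_mul_le_sqrt_mul_sqrt _ _ _
      _ ≤ _ := by
          refine mul_le_mul_of_nonneg_left ?_ (Real.sqrt_nonneg _)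
          exact Real.sqrt_le_iff.2 ⟨norm_nonneg _, b.orthonormal.sum_inner_products_le x⟩
  refine isCompactOperator_of_tendsto (F := R) (l := Filter.atTop) ?_ (Filter.Eventually.of_forall hR)
  rw [Metric.tendsto_atTop]
  intro ε hε
  obtain ⟨s, hs⟩ := summable_iff_vanishing_norm.1 hT ((ε / 2) ^ 2) (by positivity)
  refine ⟨s, fun t hst => ?_⟩
  rw [dist_eq_norm, norm_sub_rev]
  refine lt_of_le_of_lt (ContinuousLinearMap.opNorm_le_bound _ (half_pos hε).le fun x => ?_)
    (half_lt_self hε)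
  rw [sub_apply]
  refine le_of_tendsto ((hTx x).sub_const (R t x)).norm ?_
  filter_upwards [Filter.eventually_ge_atTop t] with t' ht'
  refine (hbound t t' ht' x).trans (mul_le_mul_of_nonneg_right ?_ (norm_nonneg _))
  refine Real.sqrt_le_iff.2 ⟨(half_pos hε).le, ?_⟩
  have h1 := hs (t' \ t) (Finset.sdiff_disjoint.mono_right hst)
  exact (le_abs_self _).trans h1.le

end HilbertSchmidt

/-! ### Diagonalization of normal matrices and of compact symmetric operators -/

section NormalMatrix

open Module.End

/-- A normal endomorphism is unitarily diagonalizable. -/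
theorem exists_orthonormalBasis_of_normal {V : Type*} [NormedAddCommGroup V]
    [InnerProductSpace ℂ V] [FiniteDimensional ℂ V] {d a : Module.End ℂ V}
    (hda : ∀ x y : V, ⟪d x, y⟫_ℂ = ⟪x, a y⟫_ℂ) (hc : a * d = d * a) :
    ∃ (b : OrthonormalBasis (Fin (Module.finrank ℂ V)) ℂ V) (l : Fin (Module.finrank ℂ V) → ℂ),
      ∀ i, d (b i) = l i • b i ∧ a (b i) = conj (l i) • b i := by
  have had : ∀ x y : V, ⟪a x, y⟫_ℂ = ⟪x, d y⟫_ℂ := by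
    intro x y
    rw [← inner_conj_symm, ← hda, inner_conj_symm]
  -- The Cartesian parts d + a and i(d - a) are symmetric and commute, so their joint eigenspaces
  -- decompose V.
  have hp : (d + a).IsSymmetric := by
    intro x y
    simp only [LinearMap.add_apply, inner_add_left, inner_add_right, hda, had]
    ring
  have hm : (Complex.I • (d - a)).IsSymmetric := by
    intro x y
    simp only [LinearMap.smul_apply, LinearMap.sub_apply, inner_smul_left, inner_smul_right,
      inner_sub_left, inner_sub_right, hda, had, Complex.conj_I]
    ring
  have hcomm : Commute (d + a) (Complex.I • (d - a)) := by
    refine Commute.smul_right ?_ _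
    have : Commute a d := hc
    exact ((Commute.refl d).sub_right this.symm).add_left (this.sub_right (Commute.refl a))
  have hint := LinearMap.IsSymmetric.directSum_isInternal_of_commute hp hm hcomm
  have hort := LinearMap.IsSymmetric.orthogonalFamily_eigenspace_inf_eigenspace hp hm
  classical
  -- An adapted basis needs a finite index set, which is obtained by discarding the zero joint
  -- eigenspaces.
  have hint' := DirectSum.isInternal_ne_bot_iff.2 hint
  have : Finite { i : ℂ × ℂ // eigenspace (d + a) i.2 ⊓
      eigenspace (Complex.I • (d - a)) i.1 ≠ ⊥ } :=
    WellFoundedGT.finite_ne_bot_of_iSupIndep hint.submodule_iSupIndep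
  have : Fintype { i : ℂ × ℂ // eigenspace (d + a) i.2 ⊓
      eigenspace (Complex.I • (d - a)) i.1 ≠ ⊥ } := Fintype.ofFinite _
  have hort' := hort.comp (f := fun i : { i : ℂ × ℂ // eigenspace (d + a) i.2 ⊓
      eigenspace (Complex.I • (d - a)) i.1 ≠ ⊥ } => (i : ℂ × ℂ)) Subtype.val_injective
  have hb : ∃ b : OrthonormalBasis (Fin (Module.finrank ℂ V)) ℂ V, ∀ i, ∃ α β : ℂ,
      (d + a) (b i) = α • b i ∧ (Complex.I • (d - a)) (b i) = β • b i := by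
    refine ⟨hint'.subordinateOrthonormalBasis rfl hort', fun i => ?_⟩
    have := hint'.subordinateOrthonormalBasis_subordinate rfl i hort'
    exact ⟨_, _, mem_eigenspace_iff.1 this.1, mem_eigenspace_iff.1 this.2⟩
  obtain ⟨b, hb⟩ := hb
  choose α β hα hβ using hb
  have hdb : ∀ i, d (b i) = ((α i - Complex.I * β i) / 2) • b i := by
    intro i
    have e : (2 : ℂ) • d (b i) = (d + a) (b i) - Complex.I • (Complex.I • (d - a)) (b i) := by
      rw [LinearMap.smul_apply, smul_smul, Complex.I_mul_I, LinearMap.add_apply,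
        LinearMap.sub_apply, two_smul, neg_one_smul]
      abel
    rw [hα, hβ, smul_smul, ← sub_smul] at e
    rw [div_eq_inv_mul, mul_smul, ← e, smul_smul, inv_mul_cancel₀ two_ne_zero, one_smul]
  have hab : ∀ i, a (b i) = ((α i + Complex.I * β i) / 2) • b i := by
    intro i
    have e : (2 : ℂ) • a (b i) = (d + a) (b i) + Complex.I • (Complex.I • (d - a)) (b i) := by
      rw [LinearMap.smul_apply, smul_smul, Complex.I_mul_I, LinearMap.add_apply,
        LinearMap.sub_apply, two_smul, neg_one_smul]
      abel
    rw [hα, hβ, smul_smul, ← add_smul] at e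
    rw [div_eq_inv_mul, mul_smul, ← e, smul_smul, inv_mul_cancel₀ two_ne_zero, one_smul]
  have hconj : ∀ i, (α i + Complex.I * β i) / 2 = conj ((α i - Complex.I * β i) / 2) := by
    intro i
    have e := hda (b i) (b i)
    rw [hdb, hab, inner_smul_left, inner_smul_right, inner_self_eq_norm_sq_to_K,
      b.orthonormal.1 i] at e
    simpa using e.symm
  exact ⟨b, fun i => (α i - Complex.I * β i) / 2, fun i => ⟨hdb i, (hab i).trans (by rw [hconj])⟩⟩

/-- Operators that agree on the eigenvectors of a compact symmetric operator are equal. -/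
theorem ext_of_eigenspaces {E : Type*} [NormedAddCommGroup E] [InnerProductSpace ℂ E]
    [CompleteSpace E] {G S T : E →L[ℂ] E} (hG : IsCompactOperator G)
    (hsymm : G.IsSymmetric)
    (h : ∀ μ, ∀ x ∈ eigenspace (G : Module.End ℂ E) μ, S x = T x) : S = T := by
  have hdense : Dense ((⨆ μ, eigenspace (G : Module.End ℂ E) μ : Submodule ℂ E) : Set E) := by
    rw [Submodule.dense_iff_topologicalClosure_eq_top,
      Submodule.topologicalClosure_eq_top_iff]
    exact ContinuousLinearMap.orthogonalComplement_iSup_eigenspaces_eq_bot hG hsymm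
  refine ContinuousLinearMap.ext_on
    (s := ((⨆ μ, eigenspace (G : Module.End ℂ E) μ : Submodule ℂ E) : Set E)) (hdense.mono Submodule.subset_span)
    fun x hx => ?_
  have : (⨆ μ, eigenspace (G : Module.End ℂ E) μ : Submodule ℂ E) ≤
      LinearMap.eqLocus (S : E →ₗ[ℂ] E) (T : E →ₗ[ℂ] E) :=
    iSup_le fun μ x hx => h μ x hx
  exact this hx

end NormalMatrix

/-! ### Eigenspaces of G with nonzero eigenvalue -/

namespace IsLadderPair

variable {E : Type*} [NormedAddCommGroup E] [InnerProductSpace ℂ E] [CompleteSpace E]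
  {κ : ℝ} {G : E →L[ℂ] E} {D A : E →ₗ.[ℂ] E}

open Module.End

/-- A finite dimensional eigenspace of `G` is contained in the domain of `D A`. -/
theorem exists_mem_graph_of_mem_eigenspace (h : IsLadderPair κ G D A) {g : ℂ}
    [FiniteDimensional ℂ (eigenspace (G : Module.End ℂ E) g)] {x : E}
    (hx : x ∈ eigenspace (G : Module.End ℂ E) g) :
    ∃ y z, (x, y) ∈ A.graph ∧ (y, z) ∈ D.graph := by
  set V := eigenspace (G : Module.End ℂ E) g
  let L : Submodule ℂ E :=
    { carrier := {x | x ∈ V ∧ ∃ y z, (x, y) ∈ A.graph ∧ (y, z) ∈ D.graph}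
      add_mem' := by
        rintro a b ⟨ha, y, z, h1, h2⟩ ⟨hb, y', z', h1', h2'⟩
        exact ⟨V.add_mem ha hb, _, _, graph_add_mem h1 h1', graph_add_mem h2 h2'⟩
      zero_mem' := ⟨V.zero_mem, 0, 0, A.graph.zero_mem, D.graph.zero_mem⟩
      smul_mem' := by
        rintro c a ⟨ha, y, z, h1, h2⟩
        exact ⟨V.smul_mem c ha, _, _, graph_smul_mem c h1, graph_smul_mem c h2⟩ }
  have hLV : L ≤ V := fun a ha => ha.1
  have : FiniteDimensional ℂ L := Submodule.finiteDimensional_of_le hLV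
  have hsup := Submodule.sup_orthogonal_inf_of_hasOrthogonalProjection hLV
  -- If w in V is orthogonal to L, then a = (1 + DA)⁻¹w again lies in V, since (G - g)a would
  -- otherwise be an eigenvector of DA for -1. So a lies in L, and 0 = ⟪a, w⟫ = ‖a‖² + ‖Aa‖².
  have hbot : Lᗮ ⊓ V = ⊥ := by
    rw [Submodule.eq_bot_iff]
    rintro w ⟨hw, hwV⟩
    obtain ⟨a, y, ha, hy⟩ := h.pair.symm.exists_resolvent one_pos w
    have hGw : G w = g • w := mem_eigenspace_iff.1 hwV
    have haV : a ∈ V := by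
      refine mem_eigenspace_iff.2 (sub_eq_zero.1 ?_)
      refine h.pair.symm.eq_zero_of_neg_eigenvalue one_pos
        (graph_sub_mem (h.comm' _ _ ha) (graph_smul_mem g ha)) ?_
      have := graph_sub_mem (h.comm _ _ hy) (graph_smul_mem g hy)
      convert this using 2
      rw [map_sub, hGw, map_smul]
      simp only [ContinuousLinearMap.coe_coe, Complex.ofReal_one, one_smul, smul_sub]
      abel
    have h0 : ⟪a, w⟫_ℂ = 0 := (Submodule.mem_orthogonal L w).1 hw a ⟨haV, y, _, ha, hy⟩
    have h1 := h.pair.symm.inner_eq ha hy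
    rw [inner_sub_right, h0, inner_smul_right, inner_self_eq_ofReal_norm_sq,
      inner_self_eq_ofReal_norm_sq] at h1
    have h2 : ‖y‖ ^ 2 = 0 - (1 : ℝ) * ‖a‖ ^ 2 := by exact_mod_cast h1
    have ha0 : ‖a‖ ^ 2 = 0 := by nlinarith [sq_nonneg ‖y‖, sq_nonneg ‖a‖]
    have hy0 : ‖y‖ ^ 2 = 0 := by nlinarith [sq_nonneg ‖y‖, sq_nonneg ‖a‖]
    have ha0 : a = 0 := by simpa using ha0
    have hy0 : y = 0 := by simpa using hy0
    subst ha0 hy0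
    exact graph_unique (by simpa using hy) (D.graph.zero_mem)
  rw [hbot, sup_bot_eq] at hsup
  rw [← hsup] at hx
  exact hx.2

/-- On a finite dimensional eigenspace of `G`, the operators `D` and `A` are matrices. -/
theorem exists_linearMap_eigenspace (h : IsLadderPair κ G D A) {g : ℂ}
    [FiniteDimensional ℂ (eigenspace (G : Module.End ℂ E) g)] :
    ∃ d a : Module.End ℂ (eigenspace (G : Module.End ℂ E) g),
      (∀ x : eigenspace (G : Module.End ℂ E) g, ((x : E), (d x : E)) ∈ D.graph) ∧
      (∀ x : eigenspace (G : Module.End ℂ E) g, ((x : E), (a x : E)) ∈ A.graph) ∧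
      a * d = d * a + ((κ : ℂ) * (1 - g)) • 1 := by
  set V := eigenspace (G : Module.End ℂ E) g
  have key : ∀ (X : E →ₗ.[ℂ] E), (∀ x y, (x, y) ∈ X.graph → (G x, G y) ∈ X.graph) →
      (∀ x ∈ V, ∃ y, (x, y) ∈ X.graph) →
      ∃ d : Module.End ℂ V, ∀ x : V, ((x : E), (d x : E)) ∈ X.graph := by
    intro X hX hV
    choose! y hy using hV
    have hyV : ∀ x ∈ V, y x ∈ V := by
      intro x hx
      have h1 := hX _ _ (hy x hx)
      have hGx : G x = g • x := mem_eigenspace_iff.1 hx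
      rw [hGx] at h1
      exact mem_eigenspace_iff.2 (graph_unique h1 (graph_smul_mem g (hy x hx)))
    refine ⟨{ toFun := fun x => ⟨y x, hyV x x.2⟩, map_add' := ?_, map_smul' := ?_ }, fun x => hy x x.2⟩
    · intro a b
      apply Subtype.ext
      exact graph_unique (hy _ (a + b).2) (graph_add_mem (hy a a.2) (hy b b.2))
    · intro c a
      apply Subtype.ext
      exact graph_unique (hy _ (c • a).2) (graph_smul_mem c (hy a a.2))
  have hdom : ∀ x ∈ V, ∃ y z, (x, y) ∈ A.graph ∧ (y, z) ∈ D.graph :=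
    fun x hx => h.exists_mem_graph_of_mem_eigenspace hx
  obtain ⟨a, ha⟩ := key A h.comm' fun x hx => by
    obtain ⟨y, z, h1, h2⟩ := hdom x hx
    exact ⟨y, h1⟩
  obtain ⟨d, hd⟩ := key D h.comm fun x hx => by
    obtain ⟨y, z, h1, h2⟩ := hdom x hx
    obtain ⟨y', h3, -⟩ := h.down _ _ _ h1 h2
    exact ⟨y', h3⟩
  refine ⟨d, a, hd, ha, ?_⟩
  ext x
  obtain ⟨y', h1, h2⟩ := h.down _ _ _ (ha x) (hd (a x))
  have h3 := graph_unique h1 (hd x)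
  subst h3
  have h4 := graph_unique (ha (d x)) h2
  have hGx : G x = g • (x : E) := mem_eigenspace_iff.1 x.2
  rw [hGx] at h4
  simp only [Module.End.mul_apply, LinearMap.add_apply, LinearMap.smul_apply,
    Module.End.one_apply, Submodule.coe_add, Submodule.coe_smul]
  rw [h4, mul_smul, sub_smul, one_smul]

/-- Taking traces of ad = da + κ(1 - g) gives κ(1 - g) dim V = 0. -/
theorem eigenvalue_eq_one (h : IsLadderPair κ G D A) (hκ : 0 < κ) {g : ℂ}
    [FiniteDimensional ℂ (eigenspace (G : Module.End ℂ E) g)]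
    (hg : eigenspace (G : Module.End ℂ E) g ≠ ⊥) : g = 1 := by
  obtain ⟨d, a, -, -, hc⟩ := h.exists_linearMap_eigenspace (g := g)
  have h1 := congrArg (LinearMap.trace ℂ _) hc
  rw [LinearMap.trace_mul_comm, map_add, map_smul, LinearMap.trace_one, left_eq_add,
    smul_eq_mul, mul_eq_zero, mul_eq_zero] at h1
  have hk : (κ : ℂ) ≠ 0 := by exact_mod_cast hκ.ne'
  rcases h1 with (h1 | h1) | h1
  · exact absurd h1 hk
  · linear_combination -h1
  · exact absurd (Submodule.finrank_eq_zero.1 (by exact_mod_cast h1)) hg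

/-- If `G` is compact, it is a projection of finite rank whose image is spanned by joint
eigenvectors. -/
theorem exists_orthonormal_eigenvectors (h : IsLadderPair κ G D A) (hκ : 0 < κ)
    (hG : IsCompactOperator G) :
    ∃ (n : ℕ) (u : Fin n → E) (l : Fin n → ℂ), Orthonormal ℂ u ∧
      G = ∑ i, InnerProductSpace.rankOne ℂ (u i) (u i) ∧
      (∀ i, (u i, l i • u i) ∈ D.graph) ∧ (∀ i, (u i, conj (l i) • u i) ∈ A.graph) := by
  have hsymm : (G : E →ₗ[ℂ] E).IsSymmetric :=
    ContinuousLinearMap.isSelfAdjoint_iff_isSymmetric.1 (h.isSelfAdjoint hκ)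
  have hfin : ∀ g : ℂ, g ≠ 0 → FiniteDimensional ℂ (eigenspace (G : Module.End ℂ E) g) :=
    fun g hg => ContinuousLinearMap.finite_dimensional_eigenspace hG g hg
  have := hfin 1 one_ne_zero
  obtain ⟨d, a, hd, ha, hc⟩ := h.exists_linearMap_eigenspace (g := 1)
  rw [sub_self, mul_zero, zero_smul, add_zero] at hc
  obtain ⟨b, l, hb⟩ := exists_orthonormalBasis_of_normal
    (V := eigenspace (G : Module.End ℂ E) 1)
    (fun x y => h.pair.inner_eq (hd x) (ha y)) hc
  refine ⟨_, fun i => (b i : E), fun i => l i, ?_, ?_, fun i => ?_,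
    fun i => ?_⟩
  · exact b.orthonormal.comp_linearIsometry (Submodule.subtypeₗᵢ _)
  -- Only two eigenvalues have to be compared: on ker G the sum vanishes because the b i are
  -- orthogonal to it, and for eigenvalue 1 the sum is the basis expansion.
  · refine ext_of_eigenspaces hG hsymm fun μ x hx => ?_
    have hGx : G x = μ • x := mem_eigenspace_iff.1 hx
    rw [sum_apply]
    simp only [InnerProductSpace.rankOne_apply]
    rcases eq_or_ne x 0 with rfl | hx0
    · simp
    rcases eq_or_ne μ 0 with rfl | hμ
    · rw [hGx, zero_smul, eq_comm]
      refine Finset.sum_eq_zero fun i _ => ?_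
      have e1 : G (b i) = (1 : ℂ) • (b i : E) := mem_eigenspace_iff.1 (b i).2
      have e2 : ⟪G (b i), x⟫_ℂ = ⟪(b i : E), G x⟫_ℂ := hsymm (b i) x
      rw [e1, hGx, one_smul, zero_smul, inner_zero_right] at e2
      rw [e2, zero_smul]
    · have := hfin μ hμ
      have hμ1 : μ = 1 := h.eigenvalue_eq_one hκ fun hbot => by
        rw [hbot] at hx
        exact hx0 ((Submodule.mem_bot ℂ).1 hx)
      subst hμ1
      rw [hGx, one_smul]
      have := congrArg (Submodule.subtype _) (b.sum_repr' ⟨x, hx⟩)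
      simpa using this.symm
  · have := hd (b i)
    rw [(hb i).1] at this
    exact this
  · have := ha (b i)
    rw [(hb i).2] at this
    exact this

end IsLadderPair

/-! ### Graphs of sums, products and conjugates -/

section Graphs

theorem mem_graph_neg {X : Op} {v w : Fock} : (v, w) ∈ (-X).graph ↔ (v, -w) ∈ X.graph := by
  rw [mem_graph_iff_exists, mem_graph_iff_exists]
  simp only [LinearPMap.neg_apply, neg_eq_iff_eq_neg]
  rfl

theorem mem_graph_smul {X : Op} {a : ℂ} {v w : Fock} :
    (v, w) ∈ (a • X).graph ↔ ∃ y, (v, y) ∈ X.graph ∧ a • y = w := by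
  simp only [mem_graph_iff_exists, LinearPMap.smul_apply]
  exact ⟨fun ⟨h, e⟩ => ⟨_, ⟨h, rfl⟩, e⟩, fun ⟨y, ⟨h, e⟩, e'⟩ => ⟨h, by rw [e, e']⟩⟩

theorem mem_graph_add {X Y : Op} {v w : Fock} :
    (v, w) ∈ (X + Y).graph ↔ ∃ y z, (v, y) ∈ X.graph ∧ (v, z) ∈ Y.graph ∧ y + z = w := by
  simp only [mem_graph_iff_exists, LinearPMap.add_apply]
  constructor
  · rintro ⟨⟨h, h'⟩, e⟩
    exact ⟨_, _, ⟨h, rfl⟩, ⟨h', rfl⟩, e⟩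
  · rintro ⟨y, z, ⟨h, e⟩, ⟨h', e'⟩, e''⟩
    exact ⟨⟨h, h'⟩, by rw [e, e', e'']⟩

theorem mem_graph_sub {X Y : Op} {v w : Fock} :
    (v, w) ∈ (X - Y).graph ↔ ∃ y z, (v, y) ∈ X.graph ∧ (v, z) ∈ Y.graph ∧ y - z = w := by
  simp only [mem_graph_iff_exists, LinearPMap.sub_apply]
  constructor
  · rintro ⟨⟨h, h'⟩, e⟩
    exact ⟨_, _, ⟨h, rfl⟩, ⟨h', rfl⟩, e⟩
  · rintro ⟨y, z, ⟨h, e⟩, ⟨h', e'⟩, e''⟩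
    exact ⟨⟨h, h'⟩, by rw [e, e', e'']⟩

theorem mem_graph_ofBounded {T : BOp} {v w : Fock} : (v, w) ∈ (ofBounded T).graph ↔ T v = w := by
  rw [mem_graph_iff_exists]
  exact ⟨fun ⟨_, e⟩ => e, fun e => ⟨Submodule.mem_top, e⟩⟩

theorem mem_graph_opMul {X Y : Op} {v w : Fock} :
    (v, w) ∈ (opMul X Y).graph ↔ ∃ y, (v, y) ∈ Y.graph ∧ (y, w) ∈ X.graph := by
  simp only [mem_graph_iff_exists]
  constructor
  · rintro ⟨h, e⟩
    obtain ⟨h1, h2⟩ := mem_opMul_domain.1 h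
    exact ⟨_, ⟨h1, rfl⟩, h2, e⟩
  · rintro ⟨y, ⟨h1, rfl⟩, h2, e⟩
    exact ⟨mem_opMul_domain.2 ⟨h1, h2⟩, e⟩

theorem mem_graph_opMul_ofBounded {X : Op} {T : BOp} {v w : Fock} :
    (v, w) ∈ (opMul X (ofBounded T)).graph ↔ (T v, w) ∈ X.graph := by
  simp only [mem_graph_opMul, mem_graph_ofBounded, exists_eq_left']

theorem mem_graph_ofBounded_opMul {X : Op} {T : BOp} {v w : Fock} :
    (v, w) ∈ (opMul (ofBounded T) X).graph ↔ ∃ y, (v, y) ∈ X.graph ∧ T y = w := by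
  simp only [mem_graph_opMul, mem_graph_ofBounded]

theorem mem_graph_conjOp {X : Op} {U : Fock ≃ₗᵢ[ℂ] Fock} {v w : Fock} :
    (v, w) ∈ (conjOp U X).graph ↔ (U.symm v, U.symm w) ∈ X.graph := by
  rw [conjOp, mem_graph_ofBounded_opMul]
  simp only [mem_graph_opMul_ofBounded]
  constructor
  · rintro ⟨y, h, rfl⟩
    simpa using h
  · intro h
    exact ⟨U.symm w, h, U.apply_symm_apply w⟩

theorem mem_domain_iff_graph {X : Op} {v : Fock} : v ∈ X.domain ↔ ∃ w, (v, w) ∈ X.graph :=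
  LinearPMap.mem_domain_iff

theorem commutes_iff {T : BOp} {X : Op} :
    Commutes T X ↔ ∀ v w, (v, w) ∈ X.graph → (T v, T w) ∈ X.graph := by
  simp only [mem_graph_iff_exists]
  constructor
  · rintro h v w ⟨hv, rfl⟩
    exact h ⟨v, hv⟩
  · rintro h ⟨v, hv⟩
    exact h v _ ⟨hv, rfl⟩

end Graphs

/-! ### Coordinates in the number basis -/

section NumberBasis

theorem e_apply (n m : ℕ) : e n m = if m = n then 1 else 0 := by
  simp [e, lp.single_apply, Pi.single_apply]

theorem inner_e (n : ℕ) (v : Fock) : ⟪e n, v⟫_ℂ = v n := by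
  simp [e, lp.inner_single_left]

theorem S_e (n : ℕ) : S (e n) = e (n + 1) := shift_e n

theorem S_adjoint_apply (v : Fock) (n : ℕ) : S.adjoint v n = v (n + 1) := by
  rw [← inner_e, ContinuousLinearMap.adjoint_inner_right, S_e, inner_e]

theorem S_adjoint_pow_apply (q : ℕ) (v : Fock) (n : ℕ) : (S.adjoint ^ q) v n = v (n + q) := by
  induction q generalizing v with
  | zero => simp
  | succ q ih =>
    rw [pow_succ]
    change (S.adjoint ^ q) (S.adjoint v) n = _
    rw [ih, S_adjoint_apply]
    rfl

theorem S_apply (v : Fock) (m : ℕ) : S v m = if m = 0 then 0 else v (m - 1) := by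
  rw [← inner_e, ← ContinuousLinearMap.adjoint_inner_left]
  split_ifs with h
  · subst h
    have : S.adjoint (e 0) = 0 := by
      ext n
      rw [S_adjoint_apply, e_apply]
      simp
    rw [this, inner_zero_left]
  · have : S.adjoint (e m) = e (m - 1) := by
      ext n
      rw [S_adjoint_apply, e_apply, e_apply]
      congr 1
      simp only [eq_iff_iff]
      omega
    rw [this, inner_e]

theorem S_pow_apply (q : ℕ) (v : Fock) (m : ℕ) :
    (S ^ q) v m = if m < q then 0 else v (m - q) := by
  induction q generalizing m with
  | zero => simp
  | succ q ih =>
    rw [pow_succ']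
    change S ((S ^ q) v) m = _
    rw [S_apply, ih]
    by_cases h : m = 0
    · simp [h]
    · have e1 : (m - 1 < q) = (m < q + 1) := by simp only [eq_iff_iff]; omega
      have e2 : m - 1 - q = m - (q + 1) := by omega
      simp [h, e1, e2]

theorem eq_zero_of_inner_e {v : Fock} (h : ∀ n, ⟪e n, v⟫_ℂ = 0) : v = 0 := by
  ext n
  rw [← inner_e, h]
  rfl

end NumberBasis

/-! ### Weighted shifts -/

section WeightedShift

/-- The operator `(v_n) ↦ (s_m v_{τ m})_m` on its maximal domain. -/
def weightedShift (s : ℕ → ℂ) (τ : ℕ → ℕ) : Op :=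
  maximalOp
    { toFun := fun v m => s m * v (τ m)
      map_add' := by intro v w; funext n; simp [mul_add]
      map_smul' := by intro r v; funext n; simp [mul_left_comm] }

theorem mem_graph_maximalOp {φ : (ℕ → ℂ) →ₗ[ℂ] (ℕ → ℂ)} {v w : Fock} :
    (v, w) ∈ (maximalOp φ).graph ↔ (w : ℕ → ℂ) = φ v := by
  rw [mem_graph_iff_exists]
  constructor
  · rintro ⟨h, rfl⟩
    rfl
  · intro h
    have hm : v ∈ (maximalOp φ).domain := by
      change Memℓp (φ v) 2
      rw [← h]
      exact lp.memℓp w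
    exact ⟨hm, Subtype.ext h.symm⟩

theorem mem_graph_weightedShift {s : ℕ → ℂ} {τ : ℕ → ℕ} {v w : Fock} :
    (v, w) ∈ (weightedShift s τ).graph ↔ ∀ m, w m = s m * v (τ m) := by
  rw [weightedShift, mem_graph_maximalOp, funext_iff]
  rfl

/-- `(s, τ)` describes the rows and `(t, σ)` the columns of the same infinite matrix. -/
def IsTransposed (s : ℕ → ℂ) (τ : ℕ → ℕ) (t : ℕ → ℂ) (σ : ℕ → ℕ) : Prop :=
  ∀ m n, (if n = τ m then s m else 0) = if m = σ n then t n else 0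

namespace IsTransposed

variable {s t : ℕ → ℂ} {τ σ : ℕ → ℕ}

theorem symm (h : IsTransposed s τ t σ) :
    IsTransposed (fun n => conj (t n)) σ (fun m => conj (s m)) τ := by
  intro n m
  have := congrArg (starRingEnd ℂ) (h m n)
  simpa [apply_ite (starRingEnd ℂ)] using this.symm

theorem apply_eq (h : IsTransposed s τ t σ) {m : ℕ} (hm : s m ≠ 0) :
    σ (τ m) = m ∧ t (τ m) = s m := by
  have := h m (τ m)
  rw [if_pos rfl] at this
  split_ifs at this with h1
  · exact ⟨h1.symm, this.symm⟩
  · exact absurd this hm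

theorem mem_graph_e (h : IsTransposed s τ t σ) (n : ℕ) :
    (e n, t n • e (σ n)) ∈ (weightedShift s τ).graph := by
  rw [mem_graph_weightedShift]
  intro m
  rw [lp.coeFn_smul, Pi.smul_apply, e_apply, e_apply]
  have := h m n
  simp only [smul_eq_mul, mul_ite, mul_one, mul_zero]
  rw [← this]
  simp only [eq_comm]

theorem mem_graph_e' (h : IsTransposed s τ t σ) (m : ℕ) :
    (e m, conj (s m) • e (τ m)) ∈ (weightedShift (fun n => conj (t n)) σ).graph :=
  h.symm.mem_graph_e m

/-- Each row and each column has at most one nonzero entry, so σ matches the nonzero terms of the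
two series bijectively. They are rearrangements of each other, without boundary terms. -/
theorem inner_eq (h : IsTransposed s τ t σ) {x x' y y' : Fock}
    (hx : (x, x') ∈ (weightedShift s τ).graph)
    (hy : (y, y') ∈ (weightedShift (fun n => conj (t n)) σ).graph) :
    ⟪x', y⟫_ℂ = ⟪x, y'⟫_ℂ := by
  rw [mem_graph_weightedShift] at hx hy
  have h1 := lp.hasSum_inner (𝕜 := ℂ) x' y
  have h2 := lp.hasSum_inner (𝕜 := ℂ) x y'
  refine h1.unique ?_
  refine (hasSum_iff_hasSum_of_ne_zero_bij (fun n => σ n) ?_ ?_ ?_).2 h2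
  · intro a b hab
    have ha : (starRingEnd ℂ) (t a) ≠ 0 := by
      intro h0; apply a.2; simp [hy, h0]
    have hb : (starRingEnd ℂ) (t b) ≠ 0 := by
      intro h0; apply b.2; simp [hy, h0]
    apply Subtype.ext
    rw [← (h.symm.apply_eq ha).1, ← (h.symm.apply_eq hb).1]
    exact congrArg τ hab
  · intro m hm
    have hs : s m ≠ 0 := by
      intro h0; apply hm; simp [hx, h0]
    obtain ⟨e1, e2⟩ := h.apply_eq hs
    refine ⟨⟨τ m, ?_⟩, e1⟩
    rw [Function.mem_support] at hm ⊢
    convert hm using 1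
    simp only [hx, hy, e1, e2, RCLike.inner_apply, map_mul]
    ring
  · intro a
    have ha : (starRingEnd ℂ) (t a) ≠ 0 := by
      intro h0; apply a.2; simp [hy, h0]
    obtain ⟨e1, e2⟩ := h.symm.apply_eq ha
    simp only [hx, hy, e1, e2, RCLike.inner_apply, map_mul]
    ring

/-- Maximal domains make the pair adjoint: testing against e n already reads off every coordinate of
the image. -/
theorem isAdjointPair (h : IsTransposed s τ t σ) :
    IsAdjointPair (weightedShift s τ) (weightedShift (fun n => conj (t n)) σ) where
  mem_right y y' := by
    refine ⟨fun hy x x' hx => h.inner_eq hx hy, fun H => mem_graph_weightedShift.2 fun n => ?_⟩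
    have := H _ _ (h.mem_graph_e n)
    rw [inner_smul_left, inner_e, inner_e] at this
    exact this.symm
  mem_left x x' := by
    refine ⟨fun hx y y' hy => h.inner_eq hx hy, fun H => mem_graph_weightedShift.2 fun m => ?_⟩
    have := H _ _ (h.mem_graph_e' m)
    rw [inner_smul_right, ← inner_conj_symm, inner_e, ← inner_conj_symm x, inner_e,
      ← map_mul] at this
    exact (starRingEnd ℂ).injective this

/-- An isometry that intertwines two operators on the number basis intertwines them. -/
theorem mem_graph_isometry_iff {E : Type*} [NormedAddCommGroup E] [InnerProductSpace ℂ E]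
    [CompleteSpace E] (h : IsTransposed s τ t σ) {D A : E →ₗ.[ℂ] E}
    (hDA : IsAdjointPair D A) {W : Fock →ₗᵢ[ℂ] E}
    (hD : ∀ n, (W (e n), t n • W (e (σ n))) ∈ D.graph)
    (hA : ∀ m, (W (e m), conj (s m) • W (e (τ m))) ∈ A.graph) {v : Fock} {y : E} :
    (W v, y) ∈ D.graph ↔ ∃ w, (v, w) ∈ (weightedShift s τ).graph ∧ W w = y := by
  have key : ∀ v w, (v, w) ∈ (weightedShift s τ).graph → (W v, W w) ∈ D.graph := by
    intro v w hvw
    rw [hDA.mem_left]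
    intro y y' hy
    -- W† sends the graph of A into that of the transposed shift, a condition that is checked
    -- coordinate by coordinate and hence only on basis vectors. This settles the question of
    -- domains.
    have hz : (W.toContinuousLinearMap.adjoint y, W.toContinuousLinearMap.adjoint y') ∈
        (weightedShift (fun n => conj (t n)) σ).graph := by
      rw [mem_graph_weightedShift]
      intro n
      rw [← inner_e, ← inner_e, ContinuousLinearMap.adjoint_inner_right,
        ContinuousLinearMap.adjoint_inner_right]
      have := hDA.inner_eq (hD n) hy
      rw [inner_smul_left] at this
      exact this.symm
    have := h.inner_eq hvw hz
    rwa [ContinuousLinearMap.adjoint_inner_right, ContinuousLinearMap.adjoint_inner_right] at this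
  constructor
  · intro hv
    have hw : (v, W.toContinuousLinearMap.adjoint y) ∈ (weightedShift s τ).graph := by
      rw [mem_graph_weightedShift]
      intro n
      rw [← inner_e, ContinuousLinearMap.adjoint_inner_right]
      have := hDA.symm.inner_eq (hA n) hv
      rw [inner_smul_left, Complex.conj_conj, LinearIsometry.inner_map_map, inner_e] at this
      exact this.symm
    exact ⟨_, hw, graph_unique (key _ _ hw) hv⟩
  · rintro ⟨w, hw, rfl⟩
    exact key v w hw

theorem opMul_isometry_eq (h : IsTransposed s τ t σ) {D A : Op} (hDA : IsAdjointPair D A)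
    {W : Fock →ₗᵢ[ℂ] Fock} (hD : ∀ n, (W (e n), t n • W (e (σ n))) ∈ D.graph)
    (hA : ∀ m, (W (e m), conj (s m) • W (e (τ m))) ∈ A.graph) :
    opMul D (ofBounded W.toContinuousLinearMap) =
      opMul (ofBounded W.toContinuousLinearMap) (weightedShift s τ) := by
  apply LinearPMap.eq_of_eq_graph
  ext ⟨v, w⟩
  rw [mem_graph_opMul_ofBounded, mem_graph_ofBounded_opMul]
  exact h.mem_graph_isometry_iff hDA hD hA

theorem eq_conjOp (h : IsTransposed s τ t σ) {D A : Op} (hDA : IsAdjointPair D A)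
    {U : Fock ≃ₗᵢ[ℂ] Fock} (hD : ∀ n, (U (e n), t n • U (e (σ n))) ∈ D.graph)
    (hA : ∀ m, (U (e m), conj (s m) • U (e (τ m))) ∈ A.graph) :
    D = conjOp U (weightedShift s τ) := by
  apply LinearPMap.eq_of_eq_graph
  ext ⟨v, w⟩
  have := h.mem_graph_isometry_iff hDA (W := U.toLinearIsometry) hD hA (v := U.symm v) (y := w)
  rw [mem_graph_conjOp]
  simp only [LinearIsometryEquiv.coe_toLinearIsometry, LinearIsometryEquiv.apply_symm_apply]
    at this
  rw [this]
  constructor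
  · rintro ⟨z, hz, rfl⟩
    simpa using hz
  · intro hz
    exact ⟨_, hz, U.apply_symm_apply w⟩

end IsTransposed

end WeightedShift

/-! ### The fluxon operators are weighted shifts -/

section FluxonShift

/-- The constant `1 / √(2θ)`. -/
def ladderConst (θ : ℝ) : ℂ := ((1 / Real.sqrt (2 * θ) : ℝ) : ℂ)

theorem ladderConst_ne_zero {θ : ℝ} (hθ : 0 < θ) : ladderConst θ ≠ 0 := by
  rw [ladderConst, Complex.ofReal_ne_zero]
  positivity

theorem conj_ladderConst (θ : ℝ) : conj (ladderConst θ) = ladderConst θ := Complex.conj_ofReal _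

theorem ladderConst_mul_self {θ : ℝ} (hθ : 0 < θ) :
    ladderConst θ * ladderConst θ = ((1 / (2 * θ) : ℝ) : ℂ) := by
  rw [ladderConst, ← Complex.ofReal_mul, div_mul_div_comm, one_mul,
    Real.mul_self_sqrt (by positivity)]

theorem ofReal_sqrt_mul_self {x : ℝ} (hx : 0 ≤ x) :
    (Real.sqrt x : ℂ) * (Real.sqrt x : ℂ) = x := by
  rw [← Complex.ofReal_mul, Real.mul_self_sqrt hx]

/-- The matrix elements of `-c†`. -/
def raiseCoeff (θ : ℝ) (n : ℕ) : ℂ := -(ladderConst θ * (Real.sqrt (n + 1) : ℂ))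

theorem raiseCoeff_ne_zero {θ : ℝ} (hθ : 0 < θ) (n : ℕ) : raiseCoeff θ n ≠ 0 := by
  rw [raiseCoeff, neg_ne_zero]
  refine mul_ne_zero (ladderConst_ne_zero hθ) ?_
  rw [Complex.ofReal_ne_zero]
  positivity

theorem conj_raiseCoeff (θ : ℝ) (n : ℕ) : conj (raiseCoeff θ n) = raiseCoeff θ n := by
  rw [raiseCoeff, map_neg, map_mul, conj_ladderConst, Complex.conj_ofReal]

theorem raiseCoeff_mul_self {θ : ℝ} (hθ : 0 < θ) (n : ℕ) :
    raiseCoeff θ n * raiseCoeff θ n = ((1 / (2 * θ) : ℝ) : ℂ) * (n + 1) := by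
  have h1 := ladderConst_mul_self hθ
  have h2 : (Real.sqrt (n + 1) : ℂ) * (Real.sqrt (n + 1) : ℂ) = n + 1 := by
    rw [ofReal_sqrt_mul_self (by positivity)]; push_cast; rfl
  rw [raiseCoeff, ← h1, ← h2]
  ring

/-- The rows of the matrix of `D_λ`. -/
def rowCoeff (θ : ℝ) {q : ℕ} (l : Fin q → ℂ) (m : ℕ) : ℂ :=
  if h : m < q then l ⟨m, h⟩ else if m = q then 0 else raiseCoeff θ (m - q - 1)

/-- The value at m = q is a dummy, since row q of D_λ vanishes; this also absorbs the truncated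
subtraction at q = m = 0. -/
def rowIndex (q m : ℕ) : ℕ := if m < q then m else m - 1

/-- The columns of the matrix of `D_λ`. -/
def colCoeff (θ : ℝ) {q : ℕ} (l : Fin q → ℂ) (n : ℕ) : ℂ :=
  if h : n < q then l ⟨n, h⟩ else raiseCoeff θ (n - q)

def colIndex (q n : ℕ) : ℕ := if n < q then n else n + 1

theorem isTransposed_fluxon (θ : ℝ) {q : ℕ} (l : Fin q → ℂ) :
    IsTransposed (rowCoeff θ l) (rowIndex q) (colCoeff θ l) (colIndex q) := by
  intro m n
  rw [rowCoeff, rowIndex, colCoeff, colIndex]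
  by_cases hm : m < q
  · simp only [hm, dif_pos, if_true]
    by_cases hn : n < q
    · simp only [hn, dif_pos, if_true]
      by_cases hmn : n = m
      · subst hmn; simp
      · rw [if_neg hmn, if_neg (Ne.symm hmn)]
    · simp only [hn, dif_neg, not_false_eq_true, if_false]
      rw [if_neg (by omega), if_neg (by omega)]
  · simp only [hm, dif_neg, not_false_eq_true, if_false]
    by_cases hn : n < q
    · simp only [hn, dif_pos, if_true]
      rw [if_neg (c := m = n) (by omega)]
      split_ifs with h1 h2
      · rfl
      · omega
      · rfl
    · simp only [hn, dif_neg, not_false_eq_true, if_false]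
      by_cases h1 : m = n + 1
      · subst h1
        rw [if_pos (by omega), if_neg (by omega), if_pos rfl]
        congr 1
        omega
      · rw [if_neg h1]
        by_cases h2 : m = q
        · simp [h2]
        · rw [if_neg (by omega)]

theorem mem_graph_creation {v w : Fock} :
    (v, w) ∈ creation.graph ↔ ∀ n : ℕ, w n = (Real.sqrt n : ℂ) * v (n - 1) := by
  rw [creation, mem_graph_maximalOp, funext_iff]
  rfl

theorem mem_graph_annihilation {v w : Fock} :
    (v, w) ∈ annihilation.graph ↔ ∀ n : ℕ, w n = (Real.sqrt (n + 1) : ℂ) * v (n + 1) := by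
  rw [annihilation, mem_graph_maximalOp, funext_iff]
  rfl

theorem mem_graph_const_smul {a : ℂ} (ha : a ≠ 0) {X : Op} {v w : Fock} :
    (v, w) ∈ (a • X).graph ↔ (v, a⁻¹ • w) ∈ X.graph := by
  rw [mem_graph_smul]
  constructor
  · rintro ⟨y, h, rfl⟩
    rwa [inv_smul_smul₀ ha]
  · intro h
    exact ⟨_, h, smul_inv_smul₀ ha w⟩

theorem mem_graph_cDag {θ : ℝ} (hθ : 0 < θ) {v w : Fock} :
    (v, w) ∈ (cDag θ).graph ↔
      ∀ n : ℕ, w n = ladderConst θ * (Real.sqrt n : ℂ) * v (n - 1) := by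
  rw [cDag, ← ladderConst, mem_graph_const_smul (ladderConst_ne_zero hθ), mem_graph_creation]
  refine forall_congr' fun n => ?_
  rw [lp.coeFn_smul, Pi.smul_apply, smul_eq_mul, inv_mul_eq_iff_eq_mul₀ (ladderConst_ne_zero hθ),
    mul_assoc]

theorem mem_graph_c {θ : ℝ} (hθ : 0 < θ) {v w : Fock} :
    (v, w) ∈ (c θ).graph ↔
      ∀ n : ℕ, w n = ladderConst θ * (Real.sqrt (n + 1) : ℂ) * v (n + 1) := by
  rw [c, ← ladderConst, mem_graph_const_smul (ladderConst_ne_zero hθ), mem_graph_annihilation]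
  refine forall_congr' fun n => ?_
  rw [lp.coeFn_smul, Pi.smul_apply, smul_eq_mul, inv_mul_eq_iff_eq_mul₀ (ladderConst_ne_zero hθ),
    mul_assoc]

theorem sum_smul_proj_e_apply {q : ℕ} (l : Fin q → ℂ) (v : Fock) (m : ℕ) :
    (∑ i, l i • proj (e i)) v m = if h : m < q then l ⟨m, h⟩ * v m else 0 := by
  rw [← inner_e, sum_apply, inner_sum]
  have : ∀ i : Fin q, ⟪e m, (l i • proj (e i)) v⟫_ℂ = if m = i then l i * v m else 0 := by
    intro i
    rw [smul_apply, proj, InnerProductSpace.rankOne_apply, inner_smul_right,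
      inner_smul_right, inner_e, inner_e, e_apply]
    split_ifs with h
    · subst h; ring
    · ring
  simp only [this]
  split_ifs with h
  · rw [Finset.sum_eq_single ⟨m, h⟩]
    · simp
    · intro b _ hb
      rw [if_neg]
      intro hmb
      exact hb (Fin.ext hmb.symm)
    · simp
  · refine Finset.sum_eq_zero fun i _ => ?_
    rw [if_neg]
    have := i.2
    omega

theorem fluxonD_eq {θ : ℝ} (hθ : 0 < θ) {q : ℕ} (l : Fin q → ℂ) :
    fluxonD θ l = weightedShift (rowCoeff θ l) (rowIndex q) := by
  apply LinearPMap.eq_of_eq_graph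
  ext ⟨v, w⟩
  rw [fluxonD, mem_graph_sub, mem_graph_weightedShift]
  simp only [mem_graph_ofBounded, mem_graph_ofBounded_opMul, mem_graph_opMul_ofBounded,
    mem_graph_cDag hθ]
  constructor
  · rintro ⟨_, _, rfl, ⟨y, hy, rfl⟩, rfl⟩ m
    rw [lp.coeFn_sub, Pi.sub_apply, sum_smul_proj_e_apply, S_pow_apply, rowCoeff, rowIndex]
    by_cases hm : m < q
    · simp [hm]
    · simp only [hm, dif_neg, not_false_eq_true, if_false, hy, S_adjoint_pow_apply, zero_sub]
      by_cases hq : m = q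
      · simp [hq]
      · rw [if_neg hq, raiseCoeff]
        have e1 : m - q - 1 + q = m - 1 := by omega
        have e2 : ((m - q : ℕ) : ℝ) = ((m - q - 1 : ℕ) : ℝ) + 1 := by
          have : m - q = m - q - 1 + 1 := by omega
          exact_mod_cast this
        rw [e1, e2]
        ring
  · intro h
    -- The value of c† at S†^q v must be -S†^q w, the tail of w beyond the vortices.
    refine ⟨_, _, rfl, ⟨-((S.adjoint ^ q) w), fun n => ?_, rfl⟩, ?_⟩
    · rw [lp.coeFn_neg, Pi.neg_apply, S_adjoint_pow_apply, S_adjoint_pow_apply, h, rowCoeff,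
        rowIndex]
      rw [dif_neg (by omega), if_neg (c := n + q < q) (by omega)]
      rcases Nat.eq_zero_or_pos n with hn | hn
      · subst hn; simp
      · rw [if_neg (by omega), raiseCoeff]
        have e1 : n + q - 1 = n - 1 + q := by omega
        have e2 : ((n : ℕ) : ℝ) = ((n + q - q - 1 : ℕ) : ℝ) + 1 := by
          have : n = n + q - q - 1 + 1 := by omega
          exact_mod_cast this
        rw [e1, e2]
        simp only [neg_mul, neg_neg]
    · ext m
      rw [lp.coeFn_sub, Pi.sub_apply, sum_smul_proj_e_apply, S_pow_apply]
      by_cases hm : m < q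
      · simp [hm, h m, rowCoeff, rowIndex]
      · rw [dif_neg hm, if_neg hm, lp.coeFn_neg, Pi.neg_apply, S_adjoint_pow_apply,
          Nat.sub_add_cancel (by omega)]
        ring

theorem fluxonDbar_eq {θ : ℝ} (hθ : 0 < θ) {q : ℕ} (l : Fin q → ℂ) :
    fluxonDbar θ l = -weightedShift (fun n => conj (colCoeff θ l n)) (colIndex q) := by
  apply LinearPMap.eq_of_eq_graph
  ext ⟨v, w⟩
  rw [fluxonDbar, mem_graph_add, mem_graph_neg, mem_graph_weightedShift]
  simp only [mem_graph_neg, mem_graph_ofBounded, mem_graph_ofBounded_opMul,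
    mem_graph_opMul_ofBounded, mem_graph_c hθ]
  constructor
  · rintro ⟨z, _, hz, ⟨y, hy, rfl⟩, rfl⟩ m
    obtain rfl : z = -((∑ i, conj (l i) • proj (e i)) v) := by rw [hz, neg_neg]
    rw [lp.coeFn_neg, Pi.neg_apply, lp.coeFn_add, Pi.add_apply, lp.coeFn_neg, Pi.neg_apply,
      sum_smul_proj_e_apply, S_pow_apply, colCoeff, colIndex]
    by_cases hm : m < q
    · simp [hm]
    · simp only [hm, dif_neg, not_false_eq_true, if_false, hy, S_adjoint_pow_apply,
        conj_raiseCoeff]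
      have e1 : m - q + 1 + q = m + 1 := by omega
      rw [e1, raiseCoeff]
      ring
  · intro h
    refine ⟨_, _, (neg_neg _).symm, ⟨(S.adjoint ^ q) w, fun n => ?_, rfl⟩, ?_⟩
    · have := h (n + q)
      rw [lp.coeFn_neg, Pi.neg_apply, colCoeff, colIndex, dif_neg (by omega), if_neg (by omega),
        conj_raiseCoeff, raiseCoeff, Nat.add_sub_cancel] at this
      rw [S_adjoint_pow_apply, S_adjoint_pow_apply]
      have e1 : n + 1 + q = n + q + 1 := by omega
      rw [e1]
      linear_combination -this
    · ext m
      have := h m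
      rw [lp.coeFn_neg, Pi.neg_apply, colCoeff, colIndex] at this
      rw [lp.coeFn_add, Pi.add_apply, lp.coeFn_neg, Pi.neg_apply, sum_smul_proj_e_apply,
        S_pow_apply]
      by_cases hm : m < q
      · simp only [hm, dif_pos, if_true] at this ⊢
        linear_combination this
      · rw [dif_neg hm, if_neg hm, S_adjoint_pow_apply, Nat.sub_add_cancel (by omega)]
        ring

/-- The pair (-c†, c) is the case q = 0, so statements about fluxon shifts also cover single Fock
representations. -/
theorem neg_cDag_eq {θ : ℝ} (hθ : 0 < θ) :
    -cDag θ = weightedShift (rowCoeff θ (Fin.elim0 : Fin 0 → ℂ)) (rowIndex 0) := by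
  apply LinearPMap.eq_of_eq_graph
  ext ⟨v, w⟩
  rw [mem_graph_neg, mem_graph_weightedShift, mem_graph_cDag hθ]
  refine forall_congr' fun n => ?_
  rw [lp.coeFn_neg, Pi.neg_apply, rowCoeff, rowIndex, dif_neg (by omega),
    if_neg (c := n < 0) (by omega), neg_eq_iff_eq_neg]
  rcases Nat.eq_zero_or_pos n with hn | hn
  · subst hn; simp
  · have e2 : ((n : ℕ) : ℝ) = ((n - 0 - 1 : ℕ) : ℝ) + 1 := by
      have : n = n - 0 - 1 + 1 := by omega
      exact_mod_cast this
    rw [if_neg (by omega), raiseCoeff, ← e2, neg_mul]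

theorem c_eq {θ : ℝ} (hθ : 0 < θ) :
    c θ = -weightedShift (fun n => conj (colCoeff θ (Fin.elim0 : Fin 0 → ℂ) n)) (colIndex 0) := by
  apply LinearPMap.eq_of_eq_graph
  ext ⟨v, w⟩
  rw [mem_graph_neg, mem_graph_weightedShift, mem_graph_c hθ]
  refine forall_congr' fun n => ?_
  rw [lp.coeFn_neg, Pi.neg_apply, colCoeff, colIndex, dif_neg (by omega), if_neg (by omega),
    conj_raiseCoeff, raiseCoeff, neg_mul, neg_inj]
  rfl

end FluxonShift

/-! ### Traces of finite-rank projections and the action density -/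

section Trace

theorem HasTrace.smul {T : BOp} {t : ℂ} (h : HasTrace T t) (a : ℂ) : HasTrace (a • T) (a * t) := by
  intro b
  simpa [inner_smul_right] using (h b).mul_left a

/-- The number basis. -/
def numberBasis : HilbertBasis ℕ ℂ Fock := HilbertBasis.ofRepr (LinearIsometryEquiv.refl ℂ Fock)

theorem HasTrace.unique {T : BOp} {t t' : ℂ} (h : HasTrace T t) (h' : HasTrace T t') : t = t' :=
  (h numberBasis).unique (h' numberBasis)

/-- Parseval's identity for each u i, in an arbitrary basis. -/
theorem hasTrace_sum_proj {n : ℕ} {u : Fin n → Fock} (hu : Orthonormal ℂ u) :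
    HasTrace (∑ i, proj (u i)) n := by
  intro b
  have h1 : ∀ i, HasSum (fun k => ⟪u i, b k⟫_ℂ * ⟪b k, u i⟫_ℂ) 1 := by
    intro i
    have := b.hasSum_inner_mul_inner (u i) (u i)
    rwa [inner_self_eq_ofReal_norm_sq, hu.1 i, one_pow, Complex.ofReal_one] at this
  have h2 := hasSum_sum (s := Finset.univ) fun i _ => h1 i
  simp only [Finset.sum_const, Finset.card_univ, Fintype.card_fin, nsmul_eq_mul, mul_one] at h2
  convert h2 using 2 with k
  rw [sum_apply, inner_sum]
  refine Finset.sum_congr rfl fun i _ => ?_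
  rw [proj, InnerProductSpace.rankOne_apply, inner_smul_right]

theorem sum_proj_apply_eigen {n : ℕ} {u : Fin n → Fock} (hu : Orthonormal ℂ u) (i : Fin n) :
    (∑ j, proj (u j)) (u i) = u i := by
  classical
  rw [sum_apply]
  simp only [proj, InnerProductSpace.rankOne_apply, orthonormal_iff_ite.1 hu, ite_smul, one_smul,
    zero_smul, Finset.sum_ite_eq', Finset.mem_univ, if_true]

theorem sum_proj_mul_self {n : ℕ} {u : Fin n → Fock} (hu : Orthonormal ℂ u) :
    (∑ j, proj (u j)) * (∑ j, proj (u j)) = ∑ j, proj (u j) := by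
  ext1 v
  change (∑ j, proj (u j)) ((∑ j, proj (u j)) v) = _
  conv_lhs => rw [sum_apply (f := fun j => proj (u j)) (x := v), map_sum]
  rw [sum_apply]
  refine Finset.sum_congr rfl fun i _ => ?_
  rw [proj, InnerProductSpace.rankOne_apply, map_smul, sum_proj_apply_eigen hu]

/-- The entries F and -F contribute equally, which turns the factor 1/4 into 1/2. -/
theorem yangMills_integrand (F : BOp) :
    (-(1 / 4 : ℂ)) • ∑ i, ∑ j, fieldStrength F i j * fieldStrength F i j =
      (-(1 / 2 : ℂ)) • (F * F) := by
  simp only [fieldStrength, Fin.sum_univ_two, Matrix.of_apply, Matrix.cons_val', Matrix.cons_val_zero,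
    Matrix.cons_val_one, Matrix.cons_val_fin_one, mul_zero, zero_add, add_zero, neg_mul_neg]
  rw [← two_smul ℂ (F * F), smul_smul]
  norm_num

end Trace

/-! ### From the fluxon equations to the vortices -/

section Structure

variable {θ : ℝ} {q : ℕ} {D Dbar : Op} {F : BOp}

theorem I_div_smul_neg_I_mul_smul (hθ : 0 < θ) (F : BOp) :
    (Complex.I / θ) • ((-Complex.I * θ) • F) = F := by
  have h : (θ : ℂ) ≠ 0 := by exact_mod_cast hθ.ne'
  rw [smul_smul]
  have : Complex.I / θ * (-Complex.I * θ) = 1 := by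
    field_simp
    rw [Complex.I_sq, neg_neg]
  rw [this, one_smul]

theorem IsCurvature.apply_eq (h : IsCurvature θ D Dbar F) {x y z y' z' : Fock}
    (h1 : (x, y) ∈ D.graph) (h2 : (y, z) ∈ Dbar.graph) (h3 : (x, y') ∈ Dbar.graph)
    (h4 : (y', z') ∈ D.graph) :
    F x = (2 * Complex.I) • (z - z' + (1 / (2 * θ) : ℂ) • x) := by
  have h5 : (x, (2 * Complex.I) • (z - z' + (1 / (2 * θ) : ℂ) • x)) ∈
      ((2 * Complex.I) • (opMul Dbar D - opMul D Dbar
      + ofBounded ((1 / (2 * θ) : ℂ) • ContinuousLinearMap.id ℂ Fock))).graph := by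
    rw [mem_graph_smul]
    refine ⟨_, mem_graph_add.2 ⟨_, _, mem_graph_sub.2 ⟨_, _, mem_graph_opMul.2 ⟨y, h1, h2⟩,
      mem_graph_opMul.2 ⟨y', h3, h4⟩, rfl⟩, mem_graph_ofBounded.2 rfl, rfl⟩, rfl⟩
  exact mem_graph_ofBounded.1 (LinearPMap.le_graph_of_le h.curvature_eq h5)

/-- With D̄ = -A the curvature is F = 2i(DA - AD + κ), so G = -iθF satisfies AD - DA = κ(1 - G). The
two inclusions between the natural domains of D̄D and DD̄ provide `up` and `down`. -/
theorem IsFluxonWithCurvature.isLadderPair (hθ : 0 < θ) (h : IsFluxonWithCurvature θ q D Dbar F) :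
    IsLadderPair (1 / (2 * θ)) ((-Complex.I * θ) • F) D D.adjoint := by
  have hbar : ∀ x y, (x, y) ∈ Dbar.graph ↔ (x, -y) ∈ D.adjoint.graph := by
    intro x y
    rw [h.antiHermitean, mem_graph_neg]
  have hA : ∀ x y, (x, y) ∈ D.adjoint.graph ↔ (x, -y) ∈ Dbar.graph := by
    intro x y
    rw [hbar, neg_neg]
  have hθ' : (θ : ℂ) ≠ 0 := by exact_mod_cast hθ.ne'
  have hG : ∀ x z z' : Fock, F x = (2 * Complex.I) • (z - z' + (1 / (2 * θ) : ℂ) • x) →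
      (((1 / (2 * θ) : ℝ)) : ℂ) • (x - ((-Complex.I * θ) • F) x) = z' - z := by
    intro x z z' hF
    rw [smul_apply, hF, smul_smul, smul_sub, smul_smul, smul_add, smul_sub, smul_smul]
    have e1 : (((1 / (2 * θ) : ℝ)) : ℂ) * (-Complex.I * θ * (2 * Complex.I)) = 1 := by
      push_cast
      field_simp
      rw [Complex.I_sq]
      ring
    rw [e1]
    push_cast
    module
  refine ⟨IsAdjointPair.of_adjoint h.dense_domain h.closed, fun x y z h1 h2 => ?_,
    fun x y z h1 h2 => ?_, fun x y h1 => ?_, fun x y h1 => ?_⟩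
  · have hx : x ∈ (opMul D Dbar).domain := by
      rw [← h.isCurvature.domain_eq, mem_domain_iff_graph]
      exact ⟨_, mem_graph_opMul.2 ⟨y, h1, (hA _ _).1 h2⟩⟩
    obtain ⟨w, hw⟩ := mem_domain_iff_graph.1 hx
    obtain ⟨y', h3, h4⟩ := mem_graph_opMul.1 hw
    have hF := h.isCurvature.apply_eq h1 ((hA _ _).1 h2) h3 h4
    refine ⟨-y', (hbar _ _).1 h3, ?_⟩
    rw [hG _ _ _ hF]
    have : (-y', -w) ∈ D.graph := D.graph.neg_mem h4
    convert this using 2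
    abel
  · have hx : x ∈ (opMul Dbar D).domain := by
      rw [h.isCurvature.domain_eq, mem_domain_iff_graph]
      have h2' : (-y, -z) ∈ D.graph := D.graph.neg_mem h2
      exact ⟨_, mem_graph_opMul.2 ⟨-y, (hA _ _).1 h1, h2'⟩⟩
    obtain ⟨w, hw⟩ := mem_domain_iff_graph.1 hx
    obtain ⟨y', h3, h4⟩ := mem_graph_opMul.1 hw
    have hF := h.isCurvature.apply_eq h3 h4 ((hA _ _).1 h1) (D.graph.neg_mem h2)
    refine ⟨y', h3, (hA _ _).2 ?_⟩
    rw [hG _ _ _ hF]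
    convert h4 using 2
    change -(z + (-z - w)) = w
    abel
  · exact graph_smul_mem _ (commutes_iff.1 h.yangMills x y h1)
  · refine graph_smul_mem _ ?_
    rw [hA] at h1 ⊢
    rw [← map_neg]
    exact commutes_iff.1 h.yangMills_bar _ _ h1

/-- Up to the factor 2θ² the action is the trace of G². As G is self-adjoint, the diagonal entries
of G² in the number basis are ‖G e_n‖². -/
theorem IsFluxonWithCurvature.isCompactOperator (hθ : 0 < θ)
    (h : IsFluxonWithCurvature θ q D Dbar F) : IsCompactOperator ((-Complex.I * θ : ℂ) • F) := by
  have hsa := (h.isLadderPair hθ).isSelfAdjoint (by positivity)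
  have hFG := I_div_smul_neg_I_mul_smul hθ F
  set G := (-Complex.I * θ : ℂ) • F
  have hθ' : (θ : ℂ) ≠ 0 := by exact_mod_cast hθ.ne'
  obtain ⟨s, t, ht, -⟩ := h.finite_action
  rw [yangMills_integrand, ← hFG] at ht
  have h2 := (ht.smul (2 * θ ^ 2 : ℂ)) numberBasis
  refine isCompactOperator_of_summable_norm_sq numberBasis G ?_
  rw [← Complex.summable_ofReal]
  refine h2.summable.congr fun n => ?_
  have e1 : (2 * θ ^ 2 : ℂ) • (-(1 / 2 : ℂ)) • ((Complex.I / θ) • G * (Complex.I / θ) • G) =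
      G * G := by
    rw [smul_mul_smul_comm, smul_smul, smul_smul]
    have : 2 * (θ : ℂ) ^ 2 * (-(1 / 2)) * (Complex.I / θ * (Complex.I / θ)) = 1 := by
      field_simp
      rw [Complex.I_sq]
      ring
    rw [this, one_smul]
  rw [e1, ← inner_self_eq_ofReal_norm_sq]
  change ⟪_, G (G _)⟫_ℂ = _
  rw [← ContinuousLinearMap.adjoint_inner_left, ContinuousLinearMap.isSelfAdjoint_iff'.1 hsa]

/-- The curvature of a `q`-fluxon is, up to a factor, the projection onto the span of `q` joint
eigenvectors. -/
theorem IsFluxonWithCurvature.exists_vortices (hθ : 0 < θ)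
    (h : IsFluxonWithCurvature θ q D Dbar F) :
    ∃ (u : Fin q → Fock) (l : Fin q → ℂ), Orthonormal ℂ u ∧
      F = (Complex.I / θ) • ∑ i, proj (u i) ∧
      (∀ i, (u i, l i • u i) ∈ D.graph) ∧ (∀ i, (u i, conj (l i) • u i) ∈ D.adjoint.graph) ∧
      IsLadderPair (1 / (2 * θ)) (∑ i, proj (u i)) D D.adjoint := by
  have hL := h.isLadderPair hθ
  have hθ' : (θ : ℂ) ≠ 0 := by exact_mod_cast hθ.ne'
  have hpi : (Real.pi : ℂ) ≠ 0 := by exact_mod_cast Real.pi_ne_zero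
  obtain ⟨n, u, l, hu, hG, hD, hA⟩ :=
    hL.exists_orthonormal_eigenvectors (by positivity) (h.isCompactOperator hθ)
  have hG : (-Complex.I * θ : ℂ) • F = ∑ i, proj (u i) := hG
  have hF : F = (Complex.I / θ) • ∑ i, proj (u i) := by
    rw [← hG, I_div_smul_neg_I_mul_smul hθ]
  obtain ⟨s, hs, hqs⟩ := h.charge
  -- The charge is (1/(2πi)) · 2πθ · (i/θ) · n = n, so the rank n of the projection is q.
  have h1 := ((hasTrace_sum_proj hu).smul (Complex.I / θ)).smul (1 / (2 * Real.pi * Complex.I))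
  rw [← hF] at h1
  have h2 := hs.unique h1
  have hqn : (q : ℂ) = n := by
    rw [hqs, h2]
    field_simp
  have hqn : q = n := by exact_mod_cast hqn
  subst hqn
  rw [hG] at hL
  exact ⟨u, l, hu, hF, hD, hA, hL⟩

theorem hasYMAction_sum_proj (hθ : 0 < θ) {u : Fin q → Fock} (hu : Orthonormal ℂ u) :
    HasYMAction θ ((Complex.I / θ) • ∑ i, proj (u i)) (Real.pi * q / θ) := by
  have hθ' : (θ : ℂ) ≠ 0 := by exact_mod_cast hθ.ne'
  refine ⟨(1 / (2 * θ ^ 2) : ℂ) * q, ?_, ?_⟩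
  · rw [yangMills_integrand, smul_mul_smul_comm, sum_proj_mul_self hu, smul_smul]
    have : (-(1 / 2) * (Complex.I / θ * (Complex.I / θ)) : ℂ) = 1 / (2 * θ ^ 2) := by
      field_simp
      rw [Complex.I_sq]
      ring
    rw [this]
    exact (hasTrace_sum_proj hu).smul _
  · push_cast
    field_simp

end Structure

/-! ### Ladders over the vacua and the isometries they define -/

section Ladders

/-- Every vacuum generates a ladder of states. -/
theorem IsLadderPair.exists_ladder {E : Type*} [NormedAddCommGroup E] [InnerProductSpace ℂ E]
    {θ : ℝ} (hθ : 0 < θ) {G : E →L[ℂ] E} {D A : E →ₗ.[ℂ] E}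
    (h : IsLadderPair (1 / (2 * θ)) G D A) {w : E} (hGw : G w = 0) (hAw : (w, 0) ∈ A.graph) :
    ∃ f : ℕ → E, f 0 = w ∧ (∀ n, G (f n) = 0) ∧
      (∀ n, (f n, raiseCoeff θ n • f (n + 1)) ∈ D.graph) ∧
      (∀ n, (f (n + 1), raiseCoeff θ n • f n) ∈ A.graph) := by
  set κ : ℝ := 1 / (2 * θ) with hκ
  -- The invariant DAx = κn x on ker G gives ADx = κ(n + 1)x through `down`, which also supplies
  -- that x is in the domain of AD. Since r_n² = κ(n + 1), dividing Dx by r_n makes the lowering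
  -- coefficient r_n as well.
  let Q : ℕ → E → Prop := fun n x =>
    G x = 0 ∧ ∃ y, (x, y) ∈ A.graph ∧ (y, ((κ : ℂ) * n) • x) ∈ D.graph
  have step : ∀ n x, Q n x → ∃ x', Q (n + 1) x' ∧ (x, raiseCoeff θ n • x') ∈ D.graph ∧
      (x', raiseCoeff θ n • x) ∈ A.graph := by
    rintro n x ⟨hG, y, h1, h2⟩
    obtain ⟨y', h3, h4⟩ := h.down _ _ _ h1 h2
    have hr := raiseCoeff_ne_zero hθ n
    have hrr : raiseCoeff θ n * raiseCoeff θ n = (κ : ℂ) * (n + 1) := raiseCoeff_mul_self hθ n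
    have h5 : ((raiseCoeff θ n)⁻¹ • y', raiseCoeff θ n • x) ∈ A.graph := by
      have := graph_smul_mem (raiseCoeff θ n)⁻¹ h4
      rw [hG, sub_zero, ← add_smul, smul_smul] at this
      convert this using 3
      refine mul_left_cancel₀ hr ?_
      rw [mul_inv_cancel_left₀ hr, hrr]
      ring
    refine ⟨(raiseCoeff θ n)⁻¹ • y', ⟨?_, _, h5, ?_⟩, ?_, h5⟩
    · have h6 := h.comm _ _ h3
      rw [hG] at h6
      rw [map_smul, graph_unique h6 D.graph.zero_mem, smul_zero]
    · have := graph_smul_mem (raiseCoeff θ n) h3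
      convert this using 2
      rw [smul_smul]
      congr 1
      refine mul_right_cancel₀ hr ?_
      rw [mul_assoc _ _ (raiseCoeff θ n), inv_mul_cancel₀ hr, mul_one, hrr, Nat.cast_add_one]
    · rwa [smul_inv_smul₀ hr]
  choose! next hnext using step
  let f : ℕ → E := fun n => Nat.rec w (fun n x => next n x) n
  have hQ : ∀ n, Q n (f n) := by
    intro n
    induction n with
    | zero =>
      refine ⟨hGw, 0, hAw, ?_⟩
      rw [Nat.cast_zero, mul_zero, zero_smul]
      exact D.graph.zero_mem
    | succ n ih => exact (hnext n _ ih).1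
  exact ⟨f, rfl, fun n => (hQ n).1, fun n => (hnext n _ (hQ n)).2.1,
    fun n => (hnext n _ (hQ n)).2.2⟩

/-- Moving D to the other side as A lowers both indices by one; whichever ladder reaches its vacuum
first kills the product unless the indices agree. -/
theorem inner_ladder {E : Type*} [NormedAddCommGroup E] [InnerProductSpace ℂ E]
    {D A : E →ₗ.[ℂ] E} (h : IsAdjointPair D A) {r : ℕ → ℂ} (hr : ∀ n, r n ≠ 0)
    (hr' : ∀ n, conj (r n) = r n) {f g : ℕ → E}
    (hfD : ∀ n, (f n, r n • f (n + 1)) ∈ D.graph)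
    (hfA0 : (f 0, 0) ∈ A.graph)
    (hgD : ∀ n, (g n, r n • g (n + 1)) ∈ D.graph) (hgA : ∀ n, (g (n + 1), r n • g n) ∈ A.graph)
    (hgA0 : (g 0, 0) ∈ A.graph) (m n : ℕ) :
    ⟪f m, g n⟫_ℂ = if m = n then ⟪f 0, g 0⟫_ℂ else 0 := by
  induction m generalizing n with
  | zero =>
    cases n with
    | zero => simp
    | succ n =>
      have := h.symm.inner_eq hfA0 (hgD n)
      rw [inner_zero_left, inner_smul_right] at this
      simpa [hr n] using this.symm
  | succ m ih =>
    cases n with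
    | zero =>
      have := h.inner_eq (hfD m) hgA0
      rw [inner_zero_right, inner_smul_left, hr'] at this
      simpa [hr m] using this
    | succ n =>
      have := h.inner_eq (hfD m) (hgA n)
      rw [inner_smul_right, inner_smul_left, hr', ih] at this
      by_cases hmn : m = n
      · subst hmn
        simpa [hr m] using this
      · simpa [hmn, hr m] using this

/-- The isometry that maps the number basis to an orthonormal sequence. -/
theorem exists_isometry {E : Type*} [NormedAddCommGroup E] [InnerProductSpace ℂ E]
    [CompleteSpace E] {f : ℕ → E} (hf : Orthonormal ℂ f) :
    ∃ W : Fock →ₗᵢ[ℂ] E, ∀ n, W (e n) = f n := by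
  refine ⟨hf.orthogonalFamily.linearIsometry, fun n => ?_⟩
  simp [e, OrthogonalFamily.linearIsometry_apply_single]

theorem inner_isometry_eq_zero {E : Type*} [NormedAddCommGroup E] [InnerProductSpace ℂ E]
    [CompleteSpace E] {W : Fock →ₗᵢ[ℂ] E} {x : E} (h : ∀ n, ⟪W (e n), x⟫_ℂ = 0) (v : Fock) :
    ⟪W v, x⟫_ℂ = 0 := by
  have : W.toContinuousLinearMap.adjoint x = 0 := by
    refine eq_zero_of_inner_e fun n => ?_
    rw [ContinuousLinearMap.adjoint_inner_right]
    exact h n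
  change ⟪W.toContinuousLinearMap v, x⟫_ℂ = 0
  rw [← ContinuousLinearMap.adjoint_inner_right, this, inner_zero_right]

/-- The part of the Hilbert space outside the vortices is a sum of Fock spaces. -/
theorem IsLadderPair.exists_isometries {θ : ℝ} (hθ : 0 < θ) {G : BOp} {D A : Op}
    (h : IsLadderPair (1 / (2 * θ)) G D A) :
    ∃ (ι : Type) (W : ι → Fock →ₗᵢ[ℂ] Fock),
      (∀ k n, G (W k (e n)) = 0) ∧
      (∀ k n, (W k (e n), raiseCoeff θ n • W k (e (n + 1))) ∈ D.graph) ∧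
      (∀ k n, (W k (e (n + 1)), raiseCoeff θ n • W k (e n)) ∈ A.graph) ∧
      (∀ k, (W k (e 0), 0) ∈ A.graph) ∧
      (∀ k k', k ≠ k' → ∀ v w, ⟪W k v, W k' w⟫_ℂ = 0) ∧
      ∀ v, G v = 0 → (∀ k n, ⟪W k (e n), v⟫_ℂ = 0) → v = 0 := by
  -- The space of vacua in ker G. It is closed because A is, so it has a Hilbert basis.
  let Ω : Submodule ℂ Fock :=
    { carrier := {w | G w = 0 ∧ (w, 0) ∈ A.graph}
      add_mem' := by
        rintro a b ⟨ha, ha'⟩ ⟨hb, hb'⟩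
        refine ⟨by rw [map_add, ha, hb, add_zero], ?_⟩
        simpa using graph_add_mem ha' hb'
      zero_mem' := ⟨map_zero G, A.graph.zero_mem⟩
      smul_mem' := by
        rintro c a ⟨ha, ha'⟩
        refine ⟨by rw [map_smul, ha, smul_zero], ?_⟩
        simpa using graph_smul_mem c ha' }
  have hΩ : IsClosed (Ω : Set Fock) :=
    (isClosed_eq G.continuous continuous_const).inter
      (h.pair.symm.isClosed_graph.preimage (by fun_prop : Continuous fun w : Fock => (w, (0 : Fock))))
  have : CompleteSpace Ω := hΩ.completeSpace_coe
  obtain ⟨ι, b, hb⟩ := exists_hilbertBasis ℂ Ω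
  have hvac : ∀ k : ι, ∃ f : ℕ → Fock, f 0 = b k ∧ (∀ n, G (f n) = 0) ∧
      (∀ n, (f n, raiseCoeff θ n • f (n + 1)) ∈ D.graph) ∧
      (∀ n, (f (n + 1), raiseCoeff θ n • f n) ∈ A.graph) :=
    fun k => h.exists_ladder hθ (b k).2.1 (b k).2.2
  choose f hf0 hfG hfD hfA using hvac
  have hfA0 : ∀ k, (f k 0, 0) ∈ A.graph := by
    intro k
    rw [hf0]
    exact (b k).2.2
  have hinner : ∀ k k' m n, ⟪f k m, f k' n⟫_ℂ = if m = n then ⟪b k, b k'⟫_ℂ else 0 := by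
    intro k k' m n
    rw [inner_ladder h.pair (raiseCoeff_ne_zero hθ) (conj_raiseCoeff θ) (hfD k) (hfA0 k)
      (hfD k') (hfA k') (hfA0 k'), hf0, hf0]
    rfl
  have horth : ∀ k, Orthonormal ℂ (f k) := by
    intro k
    rw [orthonormal_iff_ite]
    intro m n
    rw [hinner, inner_self_eq_ofReal_norm_sq, b.orthonormal.1 k]
    simp
  choose W hW using fun k => exists_isometry (horth k)
  refine ⟨ι, W, ?_, ?_, ?_, ?_, ?_, ?_⟩
  · intro k n; rw [hW]; exact hfG k n
  · intro k n; rw [hW, hW]; exact hfD k n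
  · intro k n; rw [hW, hW]; exact hfA k n
  · intro k; rw [hW]; exact hfA0 k
  · intro k k' hk v w
    refine inner_isometry_eq_zero (fun n => ?_) v
    rw [← inner_conj_symm, inner_isometry_eq_zero (fun m => ?_) w, map_zero]
    rw [hW, hW, hinner, b.orthonormal.2 (Ne.symm hk), ite_self]
  · intro v hv hvk
    refine h.eq_zero_of_orthogonal_ladders (f := f) (r := raiseCoeff θ) (by positivity) hfD
      (fun k n => ?_) hfA0 (fun w hGw hAw hw => ?_) hv (fun k n => ?_)
    · rw [conj_raiseCoeff]; exact hfA k n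
    · have : (⟨w, hGw, hAw⟩ : Ω) = 0 := by
        refine b.repr.injective ?_
        rw [map_zero]
        ext k
        rw [b.repr_apply_apply, lp.coeFn_zero, Pi.zero_apply]
        have := hw k
        rwa [hf0] at this
      exact congrArg Subtype.val this
    · rw [← hW]; exact hvk k n

end Ladders

/-! ### Vortices and Fock representations exhaust the Hilbert space -/

section Decomposition

variable {θ : ℝ} {q : ℕ} {D Dbar A : Op} {F : BOp}

/-- The sequence V lists the vortices at indices below q and one ladder from q on; the separate
relations combine into those of the columns of D_λ. -/
theorem mem_graph_colCoeff {l : Fin q → ℂ} {V : ℕ → Fock}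
    (hu : ∀ i : Fin q, (V i, l i • V i) ∈ D.graph)
    (hw : ∀ n, (V (q + n), raiseCoeff θ n • V (q + n + 1)) ∈ D.graph) (n : ℕ) :
    (V n, colCoeff θ l n • V (colIndex q n)) ∈ D.graph := by
  rw [colCoeff, colIndex]
  split_ifs with h
  · exact hu ⟨n, h⟩
  · have := hw (n - q)
    rwa [Nat.add_sub_cancel' (by omega)] at this

theorem mem_graph_rowCoeff {l : Fin q → ℂ} {V : ℕ → Fock}
    (hu : ∀ i : Fin q, (V i, conj (l i) • V i) ∈ A.graph) (h0 : (V q, 0) ∈ A.graph)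
    (hw : ∀ n, (V (q + n + 1), raiseCoeff θ n • V (q + n)) ∈ A.graph) (m : ℕ) :
    (V m, conj (rowCoeff θ l m) • V (rowIndex q m)) ∈ A.graph := by
  rw [rowCoeff, rowIndex]
  split_ifs with h h'
  · exact hu ⟨m, h⟩
  · rw [map_zero, zero_smul, h']
    exact h0
  · have := hw (m - q - 1)
    have e1 : q + (m - q - 1) = m - 1 := by omega
    have e2 : m - 1 + 1 = m := by omega
    rw [e1, e2] at this
    rwa [conj_raiseCoeff]

theorem neg_opMul_ofBounded (X : Op) (T : BOp) :
    opMul (-X) (ofBounded T) = -opMul X (ofBounded T) := by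
  apply LinearPMap.eq_of_eq_graph
  ext ⟨v, w⟩
  rw [mem_graph_opMul_ofBounded, mem_graph_neg, mem_graph_neg, mem_graph_opMul_ofBounded]

theorem ofBounded_opMul_neg (X : Op) (T : BOp) :
    opMul (ofBounded T) (-X) = -opMul (ofBounded T) X := by
  apply LinearPMap.eq_of_eq_graph
  ext ⟨v, w⟩
  rw [mem_graph_neg, mem_graph_ofBounded_opMul, mem_graph_ofBounded_opMul]
  constructor
  · rintro ⟨y, h, rfl⟩
    exact ⟨-y, mem_graph_neg.1 h, map_neg T y⟩
  · rintro ⟨y, h, h'⟩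
    exact ⟨-y, mem_graph_neg.2 (by rwa [neg_neg]), by rw [map_neg, h', neg_neg]⟩

theorem neg_conjOp (X : Op) (U : Fock ≃ₗᵢ[ℂ] Fock) : -conjOp U X = conjOp U (-X) := by
  apply LinearPMap.eq_of_eq_graph
  ext ⟨v, w⟩
  rw [mem_graph_neg, mem_graph_conjOp, mem_graph_conjOp, mem_graph_neg, map_neg]

theorem inner_eq_zero_of_sum_proj {u : Fin q → Fock} (hu : Orthonormal ℂ u) {v : Fock}
    (hv : (∑ i, proj (u i)) v = 0) (i : Fin q) : ⟪u i, v⟫_ℂ = 0 := by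
  have h1 := congrArg (fun w => ⟪u i, w⟫_ℂ) hv
  simp only [sum_apply, proj, InnerProductSpace.rankOne_apply, inner_zero_right] at h1
  rwa [hu.inner_right_fintype] at h1

theorem sum_proj_eq_zero {u : Fin q → Fock} {v : Fock} (hv : ∀ i, ⟪u i, v⟫_ℂ = 0) :
    (∑ i, proj (u i)) v = 0 := by
  rw [sum_apply]
  refine Finset.sum_eq_zero fun i _ => ?_
  rw [proj, InnerProductSpace.rankOne_apply, hv, zero_smul]

theorem not_finiteDimensional_fock : ¬FiniteDimensional ℂ Fock := by
  intro h
  exact not_finite_iff_infinite.2 inferInstance orthonormal_e.linearIndependent.finite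

theorem IsLadderPair.opMul_isometry_eq (hθ : 0 < θ) (hDA : IsAdjointPair D A)
    {W : Fock →ₗᵢ[ℂ] Fock}
    (hD : ∀ n, (W (e n), raiseCoeff θ n • W (e (n + 1))) ∈ D.graph)
    (hA : ∀ n, (W (e (n + 1)), raiseCoeff θ n • W (e n)) ∈ A.graph)
    (hA0 : (W (e 0), 0) ∈ A.graph) :
    opMul D (ofBounded W.toContinuousLinearMap) =
        opMul (ofBounded W.toContinuousLinearMap) (-cDag θ) ∧
      opMul (-A) (ofBounded W.toContinuousLinearMap) =
        opMul (ofBounded W.toContinuousLinearMap) (c θ) := by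
  have hT := isTransposed_fluxon θ (Fin.elim0 : Fin 0 → ℂ)
  have h1 := mem_graph_colCoeff (θ := θ) (l := (Fin.elim0 : Fin 0 → ℂ)) (V := fun n => W (e n))
    (fun i => i.elim0) (by simpa only [zero_add] using hD)
  have h2 := mem_graph_rowCoeff (θ := θ) (l := (Fin.elim0 : Fin 0 → ℂ)) (V := fun n => W (e n))
    (fun i => i.elim0) hA0 (by simpa only [zero_add] using hA)
  constructor
  · rw [neg_cDag_eq hθ]
    exact hT.opMul_isometry_eq hDA h1 h2
  · rw [c_eq hθ, neg_opMul_ofBounded, ofBounded_opMul_neg]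
    congr 1
    refine hT.symm.opMul_isometry_eq hDA.symm h2 fun m => ?_
    rw [Complex.conj_conj]
    exact h1 m

/-- Every fluxon is a sum of vortices and of copies of the Fock representation. -/
theorem IsFluxonWithCurvature.exists_decomposition (hθ : 0 < θ)
    (h : IsFluxonWithCurvature θ q D Dbar F) :
    HasYMAction θ F (Real.pi * q / θ) ∧
      ∃ (l : Fin q → ℂ) (u : Fin q → Fock) (ι : Type) (W : ι → Fock →ₗᵢ[ℂ] Fock),
        Nonempty ι ∧
        Orthonormal ℂ u ∧
        F = (Complex.I / θ) • ∑ i, proj (u i) ∧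
        (∀ i, ∃ h : u i ∈ D.domain, D ⟨u i, h⟩ = l i • u i) ∧
        (∀ i, ∃ h : u i ∈ Dbar.domain, Dbar ⟨u i, h⟩ = -(starRingEnd ℂ (l i)) • u i) ∧
        (∀ k k', k ≠ k' → ∀ v w, inner ℂ (W k v) (W k' w) = 0) ∧
        (∀ k i v, inner ℂ (u i) (W k v) = 0) ∧
        (Submodule.span ℂ (Set.range u) ⊔ ⨆ k, (W k).range).topologicalClosure = ⊤ ∧
        (∀ k, opMul D (ofBounded (W k).toContinuousLinearMap) =
          opMul (ofBounded (W k).toContinuousLinearMap) (-cDag θ)) ∧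
        (∀ k, opMul Dbar (ofBounded (W k).toContinuousLinearMap) =
          opMul (ofBounded (W k).toContinuousLinearMap) (c θ)) := by
  obtain ⟨u, l, hu, hF, hD, hA, hL⟩ := h.exists_vortices hθ
  refine ⟨by rw [hF]; exact hasYMAction_sum_proj hθ hu, ?_⟩
  obtain ⟨ι, W, hG, hWD, hWA, hW0, hWW, hvac⟩ := hL.exists_isometries hθ
  have huW : ∀ k i v, ⟪u i, W k v⟫_ℂ = 0 := by
    intro k i v
    rw [← inner_conj_symm, inner_isometry_eq_zero (fun n => ?_) v, map_zero]
    rw [← inner_conj_symm, inner_eq_zero_of_sum_proj hu (hG k n), map_zero]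
  have hzero : ∀ v, (∀ i, ⟪u i, v⟫_ℂ = 0) → (∀ k n, ⟪W k (e n), v⟫_ℂ = 0) → v = 0 :=
    fun v h1 h2 => hvac v (sum_proj_eq_zero h1) h2
  have hop := fun k => IsLadderPair.opMul_isometry_eq hθ hL.pair (hWD k) (hWA k) (hW0 k)
  refine ⟨l, u, ι, W, ?_, hu, hF, fun i => mem_graph_iff_exists.1 (hD i), fun i => ?_, hWW, huW, ?_,
    fun k => (hop k).1, fun k => ?_⟩
  -- Without a ladder the q vortices would span the infinite-dimensional Fock space.
  · by_contra hι
    rw [not_nonempty_iff] at hι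
    have hbot : (Submodule.span ℂ (Set.range u))ᗮ = ⊥ := by
      rw [Submodule.eq_bot_iff]
      intro v hv
      refine hzero v (fun i => ?_) fun k => isEmptyElim k
      exact (Submodule.mem_orthogonal _ _).1 hv _ (Submodule.subset_span ⟨i, rfl⟩)
    have : FiniteDimensional ℂ (Submodule.span ℂ (Set.range u)) :=
      FiniteDimensional.span_of_finite ℂ (Set.finite_range u)
    rw [Submodule.orthogonal_eq_bot_iff] at hbot
    refine not_finiteDimensional_fock (Module.finite_def.2 ?_)
    rw [← hbot]
    exact Submodule.fg_span (Set.finite_range u)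
  · rw [← mem_graph_iff_exists, h.antiHermitean, mem_graph_neg, neg_smul, neg_neg]
    exact hA i
  · rw [Submodule.topologicalClosure_eq_top_iff, Submodule.eq_bot_iff]
    intro v hv
    rw [Submodule.mem_orthogonal] at hv
    refine hzero v (fun i => ?_) fun k n => ?_
    · exact hv _ (Submodule.mem_sup_left (Submodule.subset_span ⟨i, rfl⟩))
    · exact hv _ (Submodule.mem_sup_right (Submodule.mem_iSup_of_mem k ⟨e n, rfl⟩))
  · rw [h.antiHermitean]
    exact (hop k).2

end Decomposition

/-! ### Reducing subspaces; kernel and image of the curvature -/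

section RankOne

variable {θ : ℝ} {q : ℕ} {D Dbar : Op} {F : BOp}

/-- An isometry that intertwines two adjoint operators with weighted shifts has a reducing range. -/
theorem IsTransposed.reduces_range {s t : ℕ → ℂ} {τ σ : ℕ → ℕ} (h : IsTransposed s τ t σ)
    {D A : Op} (hDA : IsAdjointPair D A) {W : Fock →ₗᵢ[ℂ] Fock}
    (hD : ∀ n, (W (e n), t n • W (e (σ n))) ∈ D.graph)
    (hA : ∀ m, (W (e m), conj (s m) • W (e (τ m))) ∈ A.graph)
    {M : ClosedSubmodule ℂ Fock} (hM : M.toSubmodule = W.range) : Reduces M D := by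
  -- The projection onto the range of W is WW†.
  have hproj : ∀ v, M.toSubmodule.starProjection v = W (W.toContinuousLinearMap.adjoint v) := by
    intro v
    refine Submodule.eq_starProjection_of_mem_orthogonal ?_ ?_
    · rw [hM]
      exact ⟨_, rfl⟩
    · rw [hM, Submodule.mem_orthogonal]
      rintro _ ⟨w, rfl⟩
      change ⟪W.toContinuousLinearMap w, v - W.toContinuousLinearMap _⟫_ℂ = 0
      rw [inner_sub_right, ← ContinuousLinearMap.adjoint_inner_right]
      change _ - ⟪W w, W _⟫_ℂ = 0
      rw [LinearIsometry.inner_map_map, sub_self]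
  rw [Reduces, commutes_iff]
  intro x y hxy
  rw [hproj, hproj, h.mem_graph_isometry_iff hDA hD hA]
  refine ⟨_, mem_graph_weightedShift.2 fun m => ?_, rfl⟩
  rw [← inner_e, ← inner_e, ContinuousLinearMap.adjoint_inner_right,
    ContinuousLinearMap.adjoint_inner_right]
  have := hDA.symm.inner_eq (hA m) hxy
  rw [inner_smul_left, Complex.conj_conj] at this
  exact this.symm

theorem Reduces.neg {M : ClosedSubmodule ℂ Fock} {X : Op} (h : Reduces M X) : Reduces M (-X) := by
  rw [Reduces, commutes_iff] at h ⊢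
  intro v w hvw
  rw [mem_graph_neg] at hvw ⊢
  rw [← map_neg]
  exact h v _ hvw

theorem mem_ker_smul_sum_proj {u : Fin q → Fock} (hθ : 0 < θ) {v : Fock} :
    v ∈ ((Complex.I / θ) • ∑ i, proj (u i) : BOp).ker ↔ (∑ i, proj (u i)) v = 0 := by
  have : Complex.I / (θ : ℂ) ≠ 0 := div_ne_zero Complex.I_ne_zero (by exact_mod_cast hθ.ne')
  change (Complex.I / (θ : ℂ)) • (∑ i, proj (u i)) v = 0 ↔ _
  rw [smul_eq_zero]
  exact or_iff_right this

theorem range_smul_sum_proj {u : Fin q → Fock} (hθ : 0 < θ) (hu : Orthonormal ℂ u) :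
    ((Complex.I / θ) • ∑ i, proj (u i) : BOp).range = Submodule.span ℂ (Set.range u) := by
  have hc : Complex.I / (θ : ℂ) ≠ 0 := div_ne_zero Complex.I_ne_zero (by exact_mod_cast hθ.ne')
  apply le_antisymm
  · rintro _ ⟨v, rfl⟩
    change (Complex.I / (θ : ℂ)) • (∑ i, proj (u i)) v ∈ _
    rw [sum_apply]
    refine Submodule.smul_mem _ _ (Submodule.sum_mem _ fun i _ => ?_)
    rw [proj, InnerProductSpace.rankOne_apply]
    exact Submodule.smul_mem _ _ (Submodule.subset_span ⟨i, rfl⟩)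
  · rw [Submodule.span_le]
    rintro _ ⟨i, rfl⟩
    refine ⟨(Complex.I / (θ : ℂ))⁻¹ • u i, ?_⟩
    change (Complex.I / (θ : ℂ)) • (∑ i, proj (u i)) ((Complex.I / (θ : ℂ))⁻¹ • u i) = u i
    rw [map_smul, sum_proj_apply_eigen hu, smul_inv_smul₀ hc]

end RankOne

/-! ### Normal form of a labelled rank-one fluxon -/

section Labelled

variable {θ : ℝ} {q : ℕ} {D Dbar : Op} {F : BOp}

theorem exists_unitary {V : ℕ → Fock} (hV : Orthonormal ℂ V)
    (h : ∀ v, (∀ n, ⟪V n, v⟫_ℂ = 0) → v = 0) :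
    ∃ U : Fock ≃ₗᵢ[ℂ] Fock, ∀ n, U (e n) = V n := by
  have hbot : (Submodule.span ℂ (Set.range V))ᗮ = ⊥ := by
    rw [Submodule.eq_bot_iff]
    intro v hv
    exact h v fun n => (Submodule.mem_orthogonal _ _).1 hv _ (Submodule.subset_span ⟨n, rfl⟩)
  refine ⟨(HilbertBasis.mkOfOrthogonalEqBot hV hbot).repr.symm, fun n => ?_⟩
  rw [e, HilbertBasis.repr_symm_single, HilbertBasis.coe_mkOfOrthogonalEqBot]

/-- On the kernel of its curvature, a rank one fluxon is a Fock representation. -/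
theorem IsFluxonWithCurvature.exists_isometry_ker (hθ : 0 < θ)
    (h : IsFluxonWithCurvature θ q D Dbar F) (hr : IsRankOne D Dbar F) :
    ∃ W : Fock →ₗᵢ[ℂ] Fock, F.ker = W.range ∧
      (∀ n, (W (e n), raiseCoeff θ n • W (e (n + 1))) ∈ D.graph) ∧
      (∀ n, (W (e (n + 1)), raiseCoeff θ n • W (e n)) ∈ D.adjoint.graph) ∧
      (W (e 0), 0) ∈ D.adjoint.graph := by
  obtain ⟨u, l, hu, hF, -, -, hL⟩ := h.exists_vortices hθ
  obtain ⟨ι, W, hG, hWD, hWA, hW0, hWW, hvac⟩ := hL.exists_isometries hθ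
  have hker : ∀ v, v ∈ F.ker ↔ (∑ i, proj (u i)) v = 0 := by
    intro v
    rw [hF]
    exact mem_ker_smul_sum_proj hθ
  obtain ⟨k⟩ : Nonempty ι := by
    by_contra hι
    rw [not_nonempty_iff] at hι
    refine hr.1 ((Submodule.eq_bot_iff _).2 fun v hv => ?_)
    exact hvac v ((hker v).1 hv) fun k => isEmptyElim k
  have hclosed : IsClosed ((W k).range : Set Fock) := by
    have := (W k).isometry.isClosedEmbedding.isClosed_range
    rwa [LinearMap.coe_range]
  let M : ClosedSubmodule ℂ Fock := ⟨(W k).range, hclosed⟩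
  have hM : M.toSubmodule = (W k).range := rfl
  have hMker : M.toSubmodule ≤ F.ker := by
    rw [hM]
    rintro _ ⟨v, rfl⟩
    rw [hker]
    refine sum_proj_eq_zero fun i => ?_
    rw [← inner_conj_symm]
    change conj ⟪W k v, u i⟫_ℂ = 0
    rw [inner_isometry_eq_zero (fun n => ?_) v, map_zero]
    rw [← inner_conj_symm, inner_eq_zero_of_sum_proj hu (hG k n), map_zero]
  have hT := isTransposed_fluxon θ (Fin.elim0 : Fin 0 → ℂ)
  have h1 := mem_graph_colCoeff (θ := θ) (l := (Fin.elim0 : Fin 0 → ℂ)) (V := fun n => W k (e n))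
    (fun i => i.elim0) (by simpa only [zero_add] using hWD k)
  have h2 := mem_graph_rowCoeff (θ := θ) (l := (Fin.elim0 : Fin 0 → ℂ)) (V := fun n => W k (e n))
    (fun i => i.elim0) (hW0 k) (by simpa only [zero_add] using hWA k)
  have hred : Reduces M D := hT.reduces_range hL.pair h1 h2 hM
  have hred' : Reduces M D.adjoint := hT.symm.reduces_range hL.pair.symm h2
    (fun m => by rw [Complex.conj_conj]; exact h1 m) hM
  refine ⟨W k, ?_, hWD k, hWA k, hW0 k⟩
  -- One ladder already spans a nonzero reducing subspace of ker F, so irreducibility makes it all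
  -- of ker F.
  rcases hr.2 M hMker hred (by rw [h.antiHermitean]; exact hred'.neg) with h0 | h0
  · exfalso
    have : W k (e 0) ∈ M.toSubmodule := ⟨e 0, rfl⟩
    rw [h0, Submodule.mem_bot] at this
    have h3 := congrArg norm this
    rw [LinearIsometry.norm_map, orthonormal_e.1 0, norm_zero] at h3
    exact one_ne_zero h3
  · exact h0.symm

theorem IsFluxonWithCurvature.exists_frame (hθ : 0 < θ)
    (h : IsFluxonWithCurvature θ q D Dbar F) : ∃ u : Fin q → Fock, IsVortexFrame D F u := by
  obtain ⟨u, l, hu, hF, hD, -, -⟩ := h.exists_vortices hθ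
  refine ⟨u, hu, by rw [hF, range_smul_sum_proj hθ hu], fun i => ?_⟩
  obtain ⟨h1, h2⟩ := mem_graph_iff_exists.1 (hD i)
  exact ⟨h1, l i, h2⟩

/-- D† preserves the image of F, because that image is spanned by joint eigenvectors. As the frame
diagonalizes D and is an orthonormal basis of this space, it also diagonalizes D†, with conjugate
eigenvalues. -/
theorem IsVortexFrame.exists_eigenvalues (hθ : 0 < θ) (h : IsFluxonWithCurvature θ q D Dbar F)
    {u : Fin q → Fock} (hu : IsVortexFrame D F u) :
    ∃ l : Fin q → ℂ, (∀ i, (u i, l i • u i) ∈ D.graph) ∧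
      ∀ i, (u i, conj (l i) • u i) ∈ D.adjoint.graph := by
  obtain ⟨u₀, l₀, hu₀, hF, -, hA, hL⟩ := h.exists_vortices hθ
  have hspan : Submodule.span ℂ (Set.range u) = Submodule.span ℂ (Set.range u₀) := by
    rw [hu.span_eq, hF, range_smul_sum_proj hθ hu₀]
  have hl : ∀ i, ∃ l, (u i, l • u i) ∈ D.graph := fun i => by
    obtain ⟨h1, l, h2⟩ := hu.eigenvector i
    exact ⟨l, mem_graph_iff_exists.2 ⟨h1, h2⟩⟩
  choose l hl using hl
  refine ⟨l, hl, fun i => ?_⟩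
  have hdom : ∀ x ∈ Submodule.span ℂ (Set.range u₀),
      ∃ y ∈ Submodule.span ℂ (Set.range u₀), (x, y) ∈ D.adjoint.graph := by
    intro x hx
    induction hx using Submodule.span_induction with
    | mem x hx =>
      obtain ⟨j, rfl⟩ := hx
      exact ⟨_, Submodule.smul_mem _ _ (Submodule.subset_span ⟨j, rfl⟩), hA j⟩
    | zero => exact ⟨0, Submodule.zero_mem _, D.adjoint.graph.zero_mem⟩
    | add x y _ _ hx hy =>
      obtain ⟨x', h1, h2⟩ := hx
      obtain ⟨y', h3, h4⟩ := hy
      exact ⟨_, Submodule.add_mem _ h1 h3, graph_add_mem h2 h4⟩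
    | smul a x _ hx =>
      obtain ⟨x', h1, h2⟩ := hx
      exact ⟨_, Submodule.smul_mem _ a h1, graph_smul_mem a h2⟩
  have hui : ∀ i, u i ∈ Submodule.span ℂ (Set.range u) := fun i => Submodule.subset_span ⟨i, rfl⟩
  obtain ⟨y, hy, hAy⟩ := hdom (u i) (hspan ▸ hui i)
  rw [← hspan] at hy
  have hsub : y - conj (l i) • u i = 0 := by
    have hmem : y - conj (l i) • u i ∈ Submodule.span ℂ (Set.range u) :=
      Submodule.sub_mem _ hy (Submodule.smul_mem _ _ (hui i))
    have horth : ∀ w ∈ Submodule.span ℂ (Set.range u), ⟪w, y - conj (l i) • u i⟫_ℂ = 0 := by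
      intro w hw
      induction hw using Submodule.span_induction with
      | mem w hw =>
        obtain ⟨j, rfl⟩ := hw
        have e1 := hL.pair.inner_eq (hl j) hAy
        rw [inner_sub_right, ← e1, inner_smul_left, inner_smul_right]
        by_cases hij : j = i
        · rw [hij, sub_self]
        · rw [hu.orthonormal.2 hij, mul_zero, mul_zero, sub_zero]
      | zero => exact inner_zero_left _
      | add a b _ _ ha hb => rw [inner_add_left, ha, hb, add_zero]
      | smul c a _ ha => rw [inner_smul_left, ha, mul_zero]
    exact inner_self_eq_zero.1 (horth _ hmem)
  rwa [← sub_eq_zero.1 hsub]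

theorem mem_graph_fluxonD_e (hθ : 0 < θ) (l : Fin q → ℂ) (i : Fin q) :
    (e i, l i • e i) ∈ (fluxonD θ l).graph := by
  rw [fluxonD_eq hθ]
  have := (isTransposed_fluxon θ l).mem_graph_e i
  rwa [colCoeff, colIndex, dif_pos i.2, if_pos i.2] at this

theorem eq_conjOp_fluxon (hθ : 0 < θ) {A : Op} (hDA : IsAdjointPair D A) {l : Fin q → ℂ}
    {U : Fock ≃ₗᵢ[ℂ] Fock}
    (hu : ∀ i : Fin q, (U (e i), l i • U (e i)) ∈ D.graph)
    (hw : ∀ n, (U (e (q + n)), raiseCoeff θ n • U (e (q + n + 1))) ∈ D.graph)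
    (hu' : ∀ i : Fin q, (U (e i), conj (l i) • U (e i)) ∈ A.graph)
    (h0 : (U (e q), 0) ∈ A.graph)
    (hw' : ∀ n, (U (e (q + n + 1)), raiseCoeff θ n • U (e (q + n))) ∈ A.graph) :
    D = conjOp U (fluxonD θ l) ∧ -A = conjOp U (fluxonDbar θ l) := by
  have hT := isTransposed_fluxon θ l
  have h1 := mem_graph_colCoeff (θ := θ) (l := l) (V := fun n => U (e n)) hu hw
  have h2 := mem_graph_rowCoeff (θ := θ) (l := l) (V := fun n => U (e n)) hu' h0 hw'
  rw [fluxonD_eq hθ, fluxonDbar_eq hθ, ← neg_conjOp]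
  refine ⟨hT.eq_conjOp hDA h1 h2, ?_⟩
  congr 1
  refine hT.symm.eq_conjOp hDA.symm h2 fun m => ?_
  rw [Complex.conj_conj]
  exact h1 m

theorem eigenvalue_unique {u : Fock} (hu : u ≠ 0) {a b : ℂ} (ha : (u, a • u) ∈ D.graph)
    (hb : (u, b • u) ∈ D.graph) : a = b :=
  smul_left_injective ℂ hu (graph_unique ha hb)

/-- A labelled rank one fluxon is gauge equivalent to exactly one standard one. -/
theorem IsVortexFrame.existsUnique (hθ : 0 < θ) (h : IsFluxonWithCurvature θ q D Dbar F)
    (hr : IsRankOne D Dbar F) {u : Fin q → Fock} (hu : IsVortexFrame D F u) :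
    ∃! l : Fin q → ℂ, ∃ U : Fock ≃ₗᵢ[ℂ] Fock, (∀ i : Fin q, U (e i) = u i) ∧
      D = conjOp U (fluxonD θ l) ∧ Dbar = conjOp U (fluxonDbar θ l) := by
  obtain ⟨l, hl, hl'⟩ := hu.exists_eigenvalues hθ h
  obtain ⟨W, hker, hWD, hWA, hW0⟩ := h.exists_isometry_ker hθ hr
  obtain ⟨u₀, -, hu₀, hF, -, -, hL⟩ := h.exists_vortices hθ
  have hspan : Submodule.span ℂ (Set.range u) = Submodule.span ℂ (Set.range u₀) := by
    rw [hu.span_eq, hF, range_smul_sum_proj hθ hu₀]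
  have hmem : ∀ v, v ∈ F.ker ↔ (∑ i, proj (u₀ i)) v = 0 := by
    intro v
    rw [hF]
    exact mem_ker_smul_sum_proj hθ
  have horth : ∀ v, v ∈ F.ker ↔ ∀ i, ⟪u i, v⟫_ℂ = 0 := by
    have key : ∀ (a b : Fin q → Fock) (v : Fock), Submodule.span ℂ (Set.range a) =
        Submodule.span ℂ (Set.range b) → (∀ i, ⟪b i, v⟫_ℂ = 0) → ∀ i, ⟪a i, v⟫_ℂ = 0 := by
      intro a b v hab hb i
      have : a i ∈ Submodule.span ℂ (Set.range b) := hab ▸ Submodule.subset_span ⟨i, rfl⟩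
      generalize a i = x at this ⊢
      induction this using Submodule.span_induction with
      | mem w hw => obtain ⟨j, rfl⟩ := hw; exact hb j
      | zero => exact inner_zero_left _
      | add x y _ _ hx hy => rw [inner_add_left, hx, hy, add_zero]
      | smul c x _ hx => rw [inner_smul_left, hx, mul_zero]
    intro v
    rw [hmem]
    exact ⟨fun hv => key u u₀ v hspan (inner_eq_zero_of_sum_proj hu₀ hv),
      fun hv => sum_proj_eq_zero (key u₀ u v hspan.symm hv)⟩
  have huW : ∀ i v, ⟪u i, W v⟫_ℂ = 0 := fun i v =>
    (horth _).1 (hker ▸ ⟨v, rfl⟩) i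
  have hunit : ∃ U : Fock ≃ₗᵢ[ℂ] Fock, (∀ i : Fin q, U (e i) = u i) ∧
      ∀ n, U (e (q + n)) = W (e n) := by
    -- Vortices followed by the single ladder. A vector orthogonal to all of V lies in ker F, the
    -- range of W, and there vanishes coordinatewise.
    let V : ℕ → Fock := fun n => if hn : n < q then u ⟨n, hn⟩ else W (e (n - q))
    have hV1 : ∀ n (hn : n < q), V n = u ⟨n, hn⟩ := fun n hn => dif_pos hn
    have hV2 : ∀ n, ¬n < q → V n = W (e (n - q)) := fun n hn => dif_neg hn
    have hV : Orthonormal ℂ V := by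
      rw [orthonormal_iff_ite]
      intro m n
      by_cases hm : m < q <;> by_cases hn : n < q
      · rw [hV1 m hm, hV1 n hn, orthonormal_iff_ite.1 hu.orthonormal]
        simp
      · rw [hV1 m hm, hV2 n hn, huW, if_neg (by omega)]
      · rw [hV2 m hm, hV1 n hn, ← inner_conj_symm, huW, map_zero, if_neg (by omega)]
      · rw [hV2 m hm, hV2 n hn, LinearIsometry.inner_map_map,
          orthonormal_iff_ite.1 orthonormal_e]
        congr 1
        simp only [eq_iff_iff]
        omega
    obtain ⟨U, hU⟩ := exists_unitary hV fun v hv => by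
      have hvk : v ∈ F.ker := (horth v).2 fun i => by
        rw [← hV1 i i.2]
        exact hv i
      rw [hker] at hvk
      obtain ⟨w, rfl⟩ := hvk
      have hw : w = 0 := by
        refine eq_zero_of_inner_e fun n => ?_
        have := hv (q + n)
        rw [hV2 _ (by omega), Nat.add_sub_cancel_left] at this
        exact (LinearIsometry.inner_map_map W _ _).symm.trans this
      rw [hw, map_zero]
    refine ⟨U, fun i => (hU i).trans (hV1 i i.2), fun n => ?_⟩
    rw [hU, hV2 _ (by omega), Nat.add_sub_cancel_left]
  obtain ⟨U, hU, hUW⟩ := hunit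
  refine ⟨l, ⟨U, hU, ?_⟩, ?_⟩
  · rw [h.antiHermitean]
    refine eq_conjOp_fluxon hθ hL.pair (fun i => ?_) (fun n => ?_) (fun i => ?_) ?_ fun n => ?_
    · rw [hU]; exact hl i
    · rw [add_assoc, hUW, hUW]; exact hWD n
    · rw [hU]; exact hl' i
    · have := hUW 0
      rw [add_zero] at this
      rw [this]
      exact hW0
    · rw [add_assoc, hUW, hUW]; exact hWA n
  -- Uniqueness: l' i is forced to be the eigenvalue of D at u i.
  · rintro l' ⟨U', hU', hD', -⟩
    funext i
    refine eigenvalue_unique (D := D) (hu.orthonormal.ne_zero i) ?_ (hl i)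
    rw [hD', mem_graph_conjOp, map_smul, ← hU', U'.symm_apply_apply]
    exact mem_graph_fluxonD_e hθ l' i

end Labelled

/-! ### The standard operators are fluxons -/

section Explicit

variable {θ : ℝ} {q : ℕ}

/-- If the number basis diagonalizes `X† X` and `X X†`, these operators have the same domain as soon
as their eigenvalues differ by those of a bounded operator. -/
theorem IsAdjointPair.exists_mem_graph_of_diagonal {X Y : Op} (h : IsAdjointPair X Y) {B : BOp}
    (hB : IsSelfAdjoint B) {a b : ℕ → ℝ} (ha : ∀ n, 0 ≤ a n)
    (hX : ∀ n, ∃ y, (e n, y) ∈ X.graph ∧ (y, (a n : ℂ) • e n) ∈ Y.graph)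
    (hY : ∀ n, ∃ y, (e n, y) ∈ Y.graph ∧ (y, (b n : ℂ) • e n) ∈ X.graph)
    (hBe : ∀ n, B (e n) = ((a n - b n : ℝ) : ℂ) • e n) {x y z : Fock}
    (hx : (x, y) ∈ Y.graph) (hy : (y, z) ∈ X.graph) :
    ∃ y', (x, y') ∈ X.graph ∧ (y', z + B x) ∈ Y.graph := by
  -- Solve (1 + YX)x' = XYx + Bx + x. In the eigenbasis both sides have n-th coefficients with the
  -- factor 1 + a_n, because b_n + (a_n - b_n) = a_n; hence x' = x and x is in the domain of YX.
  obtain ⟨x', y', hx', hy'⟩ := h.exists_resolvent one_pos (z + B x + x)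
  have hxx : x' - x = 0 := by
    refine eq_zero_of_inner_e fun n => ?_
    obtain ⟨p, hp, hp'⟩ := hX n
    obtain ⟨r, hr, hr'⟩ := hY n
    have e1 := (h.symm.inner_eq hp' hx').trans (h.inner_eq hp hy')
    have e2 := (h.inner_eq hr' hx).trans (h.symm.inner_eq hr hy)
    have e3 : ⟪e n, B x⟫_ℂ = ((a n - b n : ℝ) : ℂ) * ⟪e n, x⟫_ℂ := by
      rw [← ContinuousLinearMap.adjoint_inner_left, ContinuousLinearMap.isSelfAdjoint_iff'.1 hB, hBe,
        inner_smul_left, Complex.conj_ofReal]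
    rw [inner_smul_left, Complex.conj_ofReal] at e1 e2
    rw [inner_sub_right, inner_add_right, inner_add_right, e3, ← e2, Complex.ofReal_one,
      one_smul] at e1
    have hn : (1 + a n : ℂ) ≠ 0 := by
      have : 1 + a n ≠ 0 := by linarith [ha n]
      exact_mod_cast this
    refine (mul_eq_zero.1 (?_ : (1 + a n : ℂ) * _ = 0)).resolve_left hn
    rw [inner_sub_right]
    push_cast at e1
    linear_combination e1
  obtain rfl : x' = x := sub_eq_zero.1 hxx
  refine ⟨y', hx', ?_⟩
  rwa [Complex.ofReal_one, one_smul, add_sub_cancel_right] at hy'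

theorem dense_domain_of_e {X : Op} (h : ∀ n, ∃ y, (e n, y) ∈ X.graph) :
    Dense (X.domain : Set Fock) := by
  rw [Submodule.dense_iff_topologicalClosure_eq_top, Submodule.topologicalClosure_eq_top_iff,
    Submodule.eq_bot_iff]
  intro v hv
  exact eq_zero_of_inner_e fun n =>
    (Submodule.mem_orthogonal _ _).1 hv _ (mem_domain_iff_graph.2 (h n))

theorem IsAdjointPair.eq_adjoint {X Y : Op} (h : IsAdjointPair X Y)
    (hd : Dense (X.domain : Set Fock)) : Y = X.adjoint := by
  apply LinearPMap.eq_of_eq_graph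
  ext ⟨y, y'⟩
  rw [h.mem_right, (IsAdjointPair.of_adjoint hd h.isClosed_graph).mem_right]

/-- The adjoint of `D_λ`, that is `-D̄_λ`. -/
def fluxonAdj (θ : ℝ) {q : ℕ} (l : Fin q → ℂ) : Op :=
  weightedShift (fun n => conj (colCoeff θ l n)) (colIndex q)

theorem isAdjointPair_fluxon (hθ : 0 < θ) (l : Fin q → ℂ) :
    IsAdjointPair (fluxonD θ l) (fluxonAdj θ l) := by
  rw [fluxonD_eq hθ]
  exact (isTransposed_fluxon θ l).isAdjointPair

theorem fluxonDbar_eq_neg (hθ : 0 < θ) (l : Fin q → ℂ) : fluxonDbar θ l = -fluxonAdj θ l :=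
  fluxonDbar_eq hθ l

theorem mem_graph_fluxonDbar (hθ : 0 < θ) {l : Fin q → ℂ} {v w : Fock} :
    (v, w) ∈ (fluxonDbar θ l).graph ↔ (v, -w) ∈ (fluxonAdj θ l).graph := by
  rw [fluxonDbar_eq_neg hθ, mem_graph_neg]

theorem mem_graph_fluxonAdj_e (l : Fin q → ℂ) (i : Fin q) :
    (e i, conj (l i) • e i) ∈ (fluxonAdj θ l).graph := by
  have := (isTransposed_fluxon θ l).mem_graph_e' i
  rwa [rowCoeff, rowIndex, dif_pos i.2, if_pos i.2] at this

theorem mem_graph_fluxonAdj_vacuum (l : Fin q → ℂ) : (e q, 0) ∈ (fluxonAdj θ l).graph := by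
  have := (isTransposed_fluxon θ l).mem_graph_e' q
  rwa [rowCoeff, dif_neg (lt_irrefl q), if_pos rfl, map_zero, zero_smul] at this

theorem mem_graph_fluxonD_raise (hθ : 0 < θ) (l : Fin q → ℂ) (n : ℕ) :
    (e (q + n), raiseCoeff θ n • e (q + n + 1)) ∈ (fluxonD θ l).graph := by
  rw [fluxonD_eq hθ]
  have := (isTransposed_fluxon θ l).mem_graph_e (q + n)
  rwa [colCoeff, colIndex, dif_neg (by omega), if_neg (by omega), Nat.add_sub_cancel_left] at this

theorem mem_graph_fluxonAdj_lower (l : Fin q → ℂ) (n : ℕ) :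
    (e (q + n + 1), raiseCoeff θ n • e (q + n)) ∈ (fluxonAdj θ l).graph := by
  have := (isTransposed_fluxon θ l).mem_graph_e' (q + n + 1)
  have e1 : q + n + 1 - q - 1 = n := by omega
  rwa [rowCoeff, rowIndex, dif_neg (by omega), if_neg (by omega), if_neg (by omega), e1,
    conj_raiseCoeff, Nat.add_sub_cancel] at this

theorem P_apply (v : Fock) (m : ℕ) : P q v m = if m < q then v m else 0 := by
  have := sum_smul_proj_e_apply (q := q) (fun _ => 1) v m
  simp only [one_smul, one_mul, dite_eq_ite] at this
  exact this

theorem P_e_of_lt {n : ℕ} (h : n < q) : P q (e n) = e n := by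
  ext m
  rw [P_apply, e_apply]
  split_ifs <;> first | rfl | omega

theorem P_e_of_le {n : ℕ} (h : q ≤ n) : P q (e n) = 0 := by
  ext m
  rw [P_apply, e_apply, lp.coeFn_zero, Pi.zero_apply]
  split_ifs <;> first | rfl | omega

theorem orthonormal_e_fin : Orthonormal ℂ fun i : Fin q => e i :=
  orthonormal_e.comp _ Fin.val_injective

theorem isSelfAdjoint_P : IsSelfAdjoint (P q) := by
  rw [ContinuousLinearMap.isSelfAdjoint_iff']
  ext v m
  rw [← inner_e, ContinuousLinearMap.adjoint_inner_right, P_apply]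
  split_ifs with h
  · rw [P_e_of_lt h, inner_e]
  · rw [P_e_of_le (by omega), inner_zero_left]

/-- The eigenvalues of `D_λ† D_λ`. -/
def upValue (θ : ℝ) {q : ℕ} (l : Fin q → ℂ) (n : ℕ) : ℝ :=
  if h : n < q then ‖l ⟨n, h⟩‖ ^ 2 else 1 / (2 * θ) * ((n - q : ℕ) + 1)

/-- The eigenvalues of `D_λ D_λ†`. -/
def downValue (θ : ℝ) {q : ℕ} (l : Fin q → ℂ) (n : ℕ) : ℝ :=
  if h : n < q then ‖l ⟨n, h⟩‖ ^ 2 else 1 / (2 * θ) * (n - q : ℕ)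

theorem exists_up (hθ : 0 < θ) (l : Fin q → ℂ) (n : ℕ) :
    ∃ y, (e n, y) ∈ (fluxonD θ l).graph ∧ (y, (upValue θ l n : ℂ) • e n) ∈ (fluxonAdj θ l).graph := by
  by_cases h : n < q
  · refine ⟨_, mem_graph_fluxonD_e hθ l ⟨n, h⟩, ?_⟩
    have := graph_smul_mem (l ⟨n, h⟩) (mem_graph_fluxonAdj_e (θ := θ) l ⟨n, h⟩)
    rw [smul_smul, Complex.mul_conj'] at this
    rw [upValue, dif_pos h]
    exact_mod_cast this
  · obtain ⟨k, rfl⟩ := Nat.exists_eq_add_of_le (not_lt.1 h)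
    refine ⟨_, mem_graph_fluxonD_raise hθ l k, ?_⟩
    have := graph_smul_mem (raiseCoeff θ k) (mem_graph_fluxonAdj_lower (θ := θ) l k)
    rw [smul_smul, raiseCoeff_mul_self hθ] at this
    rw [upValue, dif_neg h, Nat.add_sub_cancel_left]
    exact_mod_cast this

theorem exists_down (hθ : 0 < θ) (l : Fin q → ℂ) (n : ℕ) :
    ∃ y, (e n, y) ∈ (fluxonAdj θ l).graph ∧
      (y, (downValue θ l n : ℂ) • e n) ∈ (fluxonD θ l).graph := by
  by_cases h : n < q
  · refine ⟨_, mem_graph_fluxonAdj_e l ⟨n, h⟩, ?_⟩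
    have := graph_smul_mem (conj (l ⟨n, h⟩)) (mem_graph_fluxonD_e hθ l ⟨n, h⟩)
    rw [smul_smul, mul_comm, Complex.mul_conj'] at this
    rw [downValue, dif_pos h]
    exact_mod_cast this
  · obtain ⟨k, rfl⟩ := Nat.exists_eq_add_of_le (not_lt.1 h)
    rw [downValue, dif_neg h, Nat.add_sub_cancel_left]
    cases k with
    | zero =>
      refine ⟨0, mem_graph_fluxonAdj_vacuum l, ?_⟩
      rw [Nat.cast_zero, mul_zero, Complex.ofReal_zero, zero_smul]
      exact (fluxonD θ l).graph.zero_mem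
    | succ k =>
      refine ⟨_, mem_graph_fluxonAdj_lower l k, ?_⟩
      have := graph_smul_mem (raiseCoeff θ k) (mem_graph_fluxonD_raise hθ l k)
      rw [smul_smul, raiseCoeff_mul_self hθ] at this
      exact_mod_cast this

theorem upValue_nonneg (hθ : 0 < θ) (l : Fin q → ℂ) (n : ℕ) : 0 ≤ upValue θ l n := by
  rw [upValue]
  split_ifs <;> positivity

theorem downValue_nonneg (hθ : 0 < θ) (l : Fin q → ℂ) (n : ℕ) : 0 ≤ downValue θ l n := by
  rw [downValue]
  split_ifs <;> positivity

theorem one_sub_P_e (l : Fin q → ℂ) (n : ℕ) :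
    (((1 / (2 * θ) : ℝ) : ℂ) • (1 - P q) : BOp) (e n) =
      ((upValue θ l n - downValue θ l n : ℝ) : ℂ) • e n := by
  change ((1 / (2 * θ) : ℝ) : ℂ) • (e n - P q (e n)) = _
  rw [upValue, downValue]
  split_ifs with h
  · rw [P_e_of_lt h, sub_self, sub_self, Complex.ofReal_zero, zero_smul, smul_zero]
  · rw [P_e_of_le (by omega), sub_zero]
    congr 2
    ring

theorem isSelfAdjoint_one_sub_P : IsSelfAdjoint (((1 / (2 * θ) : ℝ) : ℂ) • (1 - P q) : BOp) := by
  refine IsSelfAdjoint.smul (Complex.conj_ofReal _) ?_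
  exact (IsSelfAdjoint.one _).sub isSelfAdjoint_P

theorem fluxon_down (hθ : 0 < θ) (l : Fin q → ℂ) {x y z : Fock}
    (hx : (x, y) ∈ (fluxonAdj θ l).graph) (hy : (y, z) ∈ (fluxonD θ l).graph) :
    ∃ y', (x, y') ∈ (fluxonD θ l).graph ∧
      (y', z + (((1 / (2 * θ) : ℝ) : ℂ) • (1 - P q) : BOp) x) ∈ (fluxonAdj θ l).graph :=
  (isAdjointPair_fluxon hθ l).exists_mem_graph_of_diagonal isSelfAdjoint_one_sub_P
    (upValue_nonneg hθ l) (exists_up hθ l) (exists_down hθ l) (one_sub_P_e l) hx hy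

theorem fluxon_up (hθ : 0 < θ) (l : Fin q → ℂ) {x y z : Fock}
    (hx : (x, y) ∈ (fluxonD θ l).graph) (hy : (y, z) ∈ (fluxonAdj θ l).graph) :
    ∃ y', (x, y') ∈ (fluxonAdj θ l).graph ∧
      (y', z + (-(((1 / (2 * θ) : ℝ) : ℂ) • (1 - P q)) : BOp) x) ∈ (fluxonD θ l).graph := by
  refine (isAdjointPair_fluxon hθ l).symm.exists_mem_graph_of_diagonal isSelfAdjoint_one_sub_P.neg
    (downValue_nonneg hθ l) (exists_down hθ l) (exists_up hθ l) (fun n => ?_) hx hy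
  rw [neg_apply, one_sub_P_e l, ← neg_smul, ← Complex.ofReal_neg, neg_sub]

/-- D_λ†D_λ and D_λD_λ† are diagonal, with eigenvalues that agree below q and differ by 1/(2θ) from
q on. Their difference is the bounded operator (1 - P)/(2θ), which yields both domain inclusions and
the value of F. -/
theorem isCurvature_fluxon (hθ : 0 < θ) (l : Fin q → ℂ) :
    IsCurvature θ (fluxonD θ l) (fluxonDbar θ l) ((Complex.I / θ) • P q) where
  domain_eq := by
    ext x
    simp only [mem_domain_iff_graph, mem_graph_opMul, mem_graph_fluxonDbar hθ]
    constructor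
    · rintro ⟨z, y, h1, h2⟩
      obtain ⟨y', h3, h4⟩ := fluxon_up hθ l h1 h2
      exact ⟨_, -y', by rwa [neg_neg], (fluxonD θ l).graph.neg_mem h4⟩
    · rintro ⟨z, y, h1, h2⟩
      have h2' : (-y, -z) ∈ (fluxonD θ l).graph := (fluxonD θ l).graph.neg_mem h2
      obtain ⟨y', h3, h4⟩ := fluxon_down hθ l h1 h2'
      exact ⟨_, y', h3, by rwa [neg_neg]⟩
  curvature_eq := by
    refine LinearPMap.le_of_le_graph ?_
    rintro ⟨x, w⟩ hw
    rw [mem_graph_smul] at hw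
    obtain ⟨w, hw, rfl⟩ := hw
    rw [mem_graph_add] at hw
    obtain ⟨w, t, hw, ht, rfl⟩ := hw
    rw [mem_graph_sub] at hw
    obtain ⟨z, z', hz, hz', rfl⟩ := hw
    rw [mem_graph_ofBounded] at ht ⊢
    rw [mem_graph_opMul] at hz hz'
    obtain ⟨y, h1, h2⟩ := hz
    obtain ⟨y', h3, h4⟩ := hz'
    rw [mem_graph_fluxonDbar hθ] at h2 h3
    have h4' : (-y', -z') ∈ (fluxonD θ l).graph := (fluxonD θ l).graph.neg_mem h4
    obtain ⟨y'', h5, h6⟩ := fluxon_down hθ l h3 h4'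
    obtain rfl := graph_unique h1 h5
    have h7 := graph_unique h2 h6
    have h8 : z - z' = -(((1 / (2 * θ) : ℝ) : ℂ) • (x - P q x)) := by
      have : z = -(-z) := (neg_neg z).symm
      rw [this, h7]
      change -(-z' + ((1 / (2 * θ) : ℝ) : ℂ) • (x - P q x)) - z' = _
      abel
    rw [h8, ← ht]
    change (Complex.I / (θ : ℂ)) • P q x = (2 * Complex.I) • (_ + (1 / (2 * θ) : ℂ) • x)
    rw [← smul_neg, smul_add, smul_smul, smul_smul, neg_sub, smul_sub]
    have e1 : 2 * Complex.I * ((1 / (2 * θ) : ℝ) : ℂ) = Complex.I / θ := by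
      push_cast
      have : (θ : ℂ) ≠ 0 := by exact_mod_cast hθ.ne'
      field_simp
    have e2 : 2 * Complex.I * (1 / (2 * θ) : ℂ) = Complex.I / θ := by
      rw [← e1]; push_cast; rfl
    rw [e1, e2, sub_add_cancel]

theorem P_commutes_fluxonD (hθ : 0 < θ) (l : Fin q → ℂ) {v w : Fock}
    (h : (v, w) ∈ (fluxonD θ l).graph) : (P q v, P q w) ∈ (fluxonD θ l).graph := by
  rw [fluxonD_eq hθ, mem_graph_weightedShift] at h ⊢
  intro m
  rw [P_apply, P_apply, h, rowCoeff, rowIndex]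
  by_cases hm : m < q
  · simp [hm]
  · rw [if_neg hm, dif_neg hm, if_neg hm]
    by_cases hq : m = q
    · rw [if_pos hq, zero_mul]
    · rw [if_neg (c := m - 1 < q) (by omega), mul_zero]

theorem P_commutes_fluxonAdj (l : Fin q → ℂ) {v w : Fock}
    (h : (v, w) ∈ (fluxonAdj θ l).graph) : (P q v, P q w) ∈ (fluxonAdj θ l).graph := by
  rw [fluxonAdj, mem_graph_weightedShift] at h ⊢
  intro m
  rw [P_apply, P_apply, h, colCoeff, colIndex]
  by_cases hm : m < q
  · simp [hm]
  · rw [if_neg hm, if_neg hm, if_neg (c := m + 1 < q) (by omega), mul_zero]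

theorem dense_domain_fluxonD (hθ : 0 < θ) (l : Fin q → ℂ) :
    Dense ((fluxonD θ l).domain : Set Fock) :=
  dense_domain_of_e fun n =>
    (exists_up hθ l n).imp fun _ h => h.1

theorem isFluxonWithCurvature_fluxon (hθ : 0 < θ) (l : Fin q → ℂ) :
    IsFluxonWithCurvature θ q (fluxonD θ l) (fluxonDbar θ l) ((Complex.I / θ) • P q) where
  dense_domain := dense_domain_fluxonD hθ l
  closed := (isAdjointPair_fluxon hθ l).isClosed_graph
  antiHermitean := by
    rw [fluxonDbar_eq_neg hθ,
      (isAdjointPair_fluxon hθ l).eq_adjoint (dense_domain_fluxonD hθ l)]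
  isCurvature := isCurvature_fluxon hθ l
  yangMills := commutes_iff.2 fun v w h => graph_smul_mem _ (P_commutes_fluxonD hθ l h)
  yangMills_bar := commutes_iff.2 fun v w h => by
    refine graph_smul_mem _ ?_
    rw [mem_graph_fluxonDbar hθ] at h ⊢
    rw [← map_neg]
    exact P_commutes_fluxonAdj l h
  finite_action := ⟨_, hasYMAction_sum_proj hθ orthonormal_e_fin⟩
  charge := by
    have hθ' : (θ : ℂ) ≠ 0 := by exact_mod_cast hθ.ne'
    have hpi : (Real.pi : ℂ) ≠ 0 := by exact_mod_cast Real.pi_ne_zero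
    refine ⟨_, ((hasTrace_sum_proj orthonormal_e_fin).smul _).smul _, ?_⟩
    field_simp

theorem isVortexFrame_fluxon (hθ : 0 < θ) (l : Fin q → ℂ) :
    IsVortexFrame (fluxonD θ l) ((Complex.I / θ) • P q) (fun i : Fin q => e i) where
  orthonormal := orthonormal_e_fin
  span_eq := (range_smul_sum_proj hθ orthonormal_e_fin).symm
  eigenvector i := by
    obtain ⟨h1, h2⟩ := mem_graph_iff_exists.1 (mem_graph_fluxonD_e hθ l i)
    exact ⟨h1, l i, h2⟩

theorem hasIntegral_neg_sq (hθ : 0 < θ) :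
    HasIntegral θ (-(((Complex.I / θ) • P q) * ((Complex.I / θ) • P q)))
      ((2 * Real.pi * q / θ : ℝ) : ℂ) := by
  have hθ' : (θ : ℂ) ≠ 0 := by exact_mod_cast hθ.ne'
  have hP : P q * P q = P q := sum_proj_mul_self orthonormal_e_fin
  have h1 : -(((Complex.I / θ) • P q) * ((Complex.I / θ) • P q)) = (1 / θ ^ 2 : ℂ) • P q := by
    rw [smul_mul_smul_comm, hP, ← neg_smul]
    congr 1
    field_simp
    rw [Complex.I_sq, neg_neg]
  rw [h1]
  refine ⟨_, (hasTrace_sum_proj orthonormal_e_fin).smul _, ?_⟩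
  push_cast
  field_simp

end Explicit

/-! ### Irreducibility and gauge equivalence of the standard fluxons -/

section Classification

variable {θ : ℝ} {q : ℕ}

/-- Schur's lemma by hand: a reducing projection p below ker F maps the vacuum e q to a multiple α
of itself, D carries the same factor up the ladder, and p² = p leaves α = 0 or 1. -/
theorem isRankOne_fluxon (hθ : 0 < θ) (l : Fin q → ℂ) :
    IsRankOne (fluxonD θ l) (fluxonDbar θ l) ((Complex.I / θ) • P q) := by
  have hker : ∀ v, v ∈ ((Complex.I / θ) • P q : BOp).ker ↔ ∀ n < q, v n = 0 := by
    intro v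
    rw [P, mem_ker_smul_sum_proj hθ]
    constructor
    · intro h n hn
      rw [← inner_e]
      exact inner_eq_zero_of_sum_proj orthonormal_e_fin h ⟨n, hn⟩
    · intro h
      exact sum_proj_eq_zero fun i => by rw [inner_e]; exact h i i.2
  refine ⟨fun hbot => ?_, fun M hM hD hDbar => ?_⟩
  · have : e q ∈ ((Complex.I / θ) • P q : BOp).ker := by
      rw [hker]
      intro n hn
      rw [e_apply, if_neg (by omega)]
    rw [hbot, Submodule.mem_bot] at this
    exact orthonormal_e.ne_zero q this
  rw [Reduces, commutes_iff] at hD hDbar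
  set p := M.toSubmodule.starProjection with hp
  have hpmem : ∀ v, p v ∈ M.toSubmodule := fun v => M.toSubmodule.starProjection_apply_mem v
  have hpM : ∀ v ∈ M.toSubmodule, p v = v := fun v hv =>
    Submodule.starProjection_eq_self_iff.2 hv
  have hpinner : ∀ v w, ⟪p v, w⟫_ℂ = ⟪v, p w⟫_ℂ := fun v w =>
    M.toSubmodule.inner_starProjection_left_eq_right v w
  have hA : (p (e q), p 0) ∈ (fluxonAdj θ l).graph := by
    have h1 : (e q, (0 : Fock)) ∈ (fluxonDbar θ l).graph := by
      rw [mem_graph_fluxonDbar hθ, neg_zero]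
      exact mem_graph_fluxonAdj_vacuum l
    have h2 := hDbar _ _ h1
    rw [map_zero] at h2 ⊢
    rw [mem_graph_fluxonDbar hθ, neg_zero] at h2
    exact h2
  -- p (e q) has no coordinates below q, since it lies in ker F, and none above q, since D_λ† kills
  -- it and the lowering coefficients are nonzero.
  obtain ⟨α, hα⟩ : ∃ α : ℂ, p (e q) = α • e q := by
    refine ⟨p (e q) q, ?_⟩
    rw [map_zero, fluxonAdj, mem_graph_weightedShift] at hA
    ext m
    rw [lp.coeFn_smul, Pi.smul_apply, e_apply, smul_eq_mul]
    rcases lt_trichotomy m q with hm | hm | hm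
    · rw [if_neg (by omega), mul_zero]
      exact (hker _).1 (hM (hpmem _)) m hm
    · rw [hm, if_pos rfl, mul_one]
    · rw [if_neg (by omega), mul_zero]
      have := hA (m - 1)
      rw [colCoeff, colIndex, dif_neg (by omega), if_neg (by omega), conj_raiseCoeff,
        lp.coeFn_zero, Pi.zero_apply, Nat.sub_add_cancel (by omega)] at this
      exact (mul_eq_zero.1 this.symm).resolve_left (raiseCoeff_ne_zero hθ _)
  have hup : ∀ n, p (e (q + n)) = α • e (q + n) := by
    intro n
    induction n with
    | zero => exact hα
    | succ n ih =>
      have h1 := hD _ _ (mem_graph_fluxonD_raise hθ l n)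
      have h2 := graph_smul_mem α (mem_graph_fluxonD_raise hθ l n)
      rw [ih, map_smul] at h1
      have h3 := graph_unique h1 h2
      rw [smul_comm] at h3
      exact smul_right_injective Fock (raiseCoeff_ne_zero hθ n) h3
  have hlow : ∀ n < q, p (e n) = 0 := by
    intro n hn
    refine eq_zero_of_inner_e fun m => ?_
    rw [← hpinner, ← inner_conj_symm, inner_e, (hker _).1 (hM (hpmem _)) n hn, map_zero]
  have hαα : α = 0 ∨ α = 1 := by
    have h1 := hpM _ (hpmem (e q))
    rw [hα, map_smul, hα, smul_smul] at h1
    have h2 := smul_left_injective ℂ (orthonormal_e.ne_zero q) h1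
    rcases eq_or_ne α 0 with h0 | h0
    · exact Or.inl h0
    · exact Or.inr (mul_left_cancel₀ h0 (by rw [h2, mul_one]))
  rcases hαα with rfl | rfl
  · left
    rw [Submodule.eq_bot_iff]
    intro v hv
    refine eq_zero_of_inner_e fun n => ?_
    rw [← hpM v hv, ← hpinner]
    by_cases hn : n < q
    · rw [hlow n hn, inner_zero_left]
    · obtain ⟨k, rfl⟩ := Nat.exists_eq_add_of_le (not_lt.1 hn)
      rw [hup, zero_smul, inner_zero_left]
  · right
    refine le_antisymm hM fun v hv => ?_
    have : p v - v = 0 := by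
      refine eq_zero_of_inner_e fun n => ?_
      rw [inner_sub_right, ← hpinner]
      by_cases hn : n < q
      · rw [hlow n hn, inner_zero_left, inner_e, (hker v).1 hv n hn, sub_zero]
      · obtain ⟨k, rfl⟩ := Nat.exists_eq_add_of_le (not_lt.1 hn)
        rw [hup, one_smul, sub_self]
    rw [← sub_eq_zero.1 this]
    exact hpmem v

theorem fluxonD_injective (hθ : 0 < θ) {l m : Fin q → ℂ} (h : fluxonD θ l = fluxonD θ m) :
    l = m := by
  funext i
  refine eigenvalue_unique (D := fluxonD θ l) (orthonormal_e.ne_zero i)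
    (mem_graph_fluxonD_e hθ l i) ?_
  rw [h]
  exact mem_graph_fluxonD_e hθ m i

theorem gaugeEquiv_of_perm (hθ : 0 < θ) (l : Fin q → ℂ) (σ : Equiv.Perm (Fin q)) :
    GaugeEquiv (fluxonD θ l) (fluxonDbar θ l) (fluxonD θ (l ∘ σ)) (fluxonDbar θ (l ∘ σ)) := by
  -- The inverse is needed: e_i, with eigenvalue l i, must go to the vector on which D for l ∘ σ has
  -- eigenvalue l i, which is the one with index σ⁻¹ i.
  let π : Equiv.Perm ℕ := (σ⁻¹ : Equiv.Perm (Fin q)).extendDomain Fin.equivSubtype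
  have hπ1 : ∀ i : Fin q, π i = (σ⁻¹ : Equiv.Perm (Fin q)) i := fun i =>
    Equiv.Perm.extendDomain_apply_image _ Fin.equivSubtype i
  have hπ2 : ∀ n, ¬n < q → π n = n := fun n hn =>
    Equiv.Perm.extendDomain_apply_not_subtype _ _ hn
  obtain ⟨U, hU⟩ := exists_unitary (V := fun n => e (π n)) (orthonormal_e.comp _ π.injective)
    fun v hv => eq_zero_of_inner_e fun n => by
      have := hv (π.symm n)
      rwa [Equiv.apply_symm_apply] at this
  have hl : ∀ i, l i = (l ∘ σ) ((σ⁻¹ : Equiv.Perm (Fin q)) i) := fun i => by simp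
  refine ⟨U, ?_⟩
  rw [fluxonDbar_eq_neg hθ (l ∘ σ)]
  refine eq_conjOp_fluxon hθ (isAdjointPair_fluxon hθ _) (fun i => ?_) (fun n => ?_)
    (fun i => ?_) ?_ fun n => ?_
  · rw [hU, hπ1, hl]
    exact mem_graph_fluxonD_e hθ _ _
  · rw [hU, hU, hπ2 _ (by omega), hπ2 _ (by omega)]
    exact mem_graph_fluxonD_raise hθ _ n
  · rw [hU, hπ1, hl]
    exact mem_graph_fluxonAdj_e _ _
  · rw [hU, hπ2 _ (by omega)]
    exact mem_graph_fluxonAdj_vacuum _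
  · rw [hU, hU, hπ2 _ (by omega), hπ2 _ (by omega)]
    exact mem_graph_fluxonAdj_lower _ n

/-- A gauge transformation between fluxons maps the curvatures to each other. -/
theorem map_P_of_conjOp (hθ : 0 < θ) {l m : Fin q → ℂ} {U : Fock ≃ₗᵢ[ℂ] Fock}
    (hD : fluxonD θ m = conjOp U (fluxonD θ l))
    (hDbar : fluxonDbar θ m = conjOp U (fluxonDbar θ l)) (n : ℕ) :
    P q (U (e n)) = U (P q (e n)) := by
  have hUD : ∀ {v w}, (v, w) ∈ (fluxonD θ l).graph → (U v, U w) ∈ (fluxonD θ m).graph := by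
    intro v w h
    rw [hD, mem_graph_conjOp]
    simpa using h
  have hUDbar : ∀ {v w}, (v, w) ∈ (fluxonDbar θ l).graph →
      (U v, U w) ∈ (fluxonDbar θ m).graph := by
    intro v w h
    rw [hDbar, mem_graph_conjOp]
    simpa using h
  obtain ⟨y, h1, h2⟩ := exists_up hθ l n
  obtain ⟨y', h3, h4⟩ := exists_down hθ l n
  rw [← neg_neg ((upValue θ l n : ℂ) • e n), ← mem_graph_fluxonDbar hθ] at h2
  rw [← neg_neg y', ← mem_graph_fluxonDbar hθ] at h3
  have h4' : (-y', -((downValue θ l n : ℂ) • e n)) ∈ (fluxonD θ l).graph :=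
    (fluxonD θ l).graph.neg_mem h4
  have e1 := (isCurvature_fluxon hθ l).apply_eq h1 h2 h3 h4'
  have e2 := (isCurvature_fluxon hθ m).apply_eq (hUD h1) (hUDbar h2) (hUDbar h3) (hUD h4')
  rw [← map_sub, ← map_smul U, ← map_add, ← map_smul U, ← e1] at e2
  have hc : Complex.I / (θ : ℂ) ≠ 0 := div_ne_zero Complex.I_ne_zero (by exact_mod_cast hθ.ne')
  rw [smul_apply, smul_apply, map_smul] at e2
  exact smul_right_injective Fock hc e2

/-- U commutes with P, so its block on the vortices is an isometric square matrix. An entry u j i ≠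
0 forces m j = l i, so a single nonzero term of the determinant matches the tuples with
multiplicities. -/
theorem exists_perm_of_gaugeEquiv (hθ : 0 < θ) {l m : Fin q → ℂ}
    (h : GaugeEquiv (fluxonD θ l) (fluxonDbar θ l) (fluxonD θ m) (fluxonDbar θ m)) :
    ∃ σ : Equiv.Perm (Fin q), m = l ∘ σ := by
  obtain ⟨U, hD, hDbar⟩ := h
  let u : Matrix (Fin q) (Fin q) ℂ := Matrix.of fun j i => ⟪e j, U (e i)⟫_ℂ
  have hu : ∀ j i, u j i = ⟪e j, U (e i)⟫_ℂ := fun j i => rfl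
  have heig : ∀ j i, u j i ≠ 0 → m j = l i := by
    intro j i hji
    have h1 : (U (e i), l i • U (e i)) ∈ (fluxonD θ m).graph := by
      rw [hD, mem_graph_conjOp, ← map_smul, U.symm_apply_apply, U.symm_apply_apply]
      exact mem_graph_fluxonD_e hθ l i
    have h2 := (isAdjointPair_fluxon hθ m).symm.inner_eq (mem_graph_fluxonAdj_e m j) h1
    rw [inner_smul_left, Complex.conj_conj, inner_smul_right] at h2
    exact mul_right_cancel₀ hji h2
  have hunit : u.conjTranspose * u = 1 := by
    ext i i'
    rw [Matrix.mul_apply]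
    have h1 : P q (U (e i')) = U (e i') := by
      rw [map_P_of_conjOp hθ hD hDbar, P_e_of_lt i'.2]
    have h2 : ⟪U (e i), P q (U (e i'))⟫_ℂ = ∑ j, star (u j i) * u j i' := by
      rw [P, sum_apply, inner_sum]
      refine Finset.sum_congr rfl fun j _ => ?_
      rw [proj, InnerProductSpace.rankOne_apply, inner_smul_right, hu, hu, mul_comm]
      congr 1
      exact (inner_conj_symm _ _).symm
    simp only [Matrix.conjTranspose_apply]
    rw [← h2, h1, LinearIsometryEquiv.inner_map_map, orthonormal_iff_ite.1 orthonormal_e,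
      Matrix.one_apply]
    simp only [Fin.ext_iff]
  have hdet : u.det ≠ 0 := Matrix.det_ne_zero_of_left_inverse hunit
  rw [Matrix.det_apply] at hdet
  obtain ⟨σ, -, hσ⟩ := Finset.exists_ne_zero_of_sum_ne_zero hdet
  -- The factors of the nonzero term are u (σ i) i, giving m (σ i) = l i.
  refine ⟨σ⁻¹, funext fun j => ?_⟩
  have hprod : ∏ i, u (σ i) i ≠ 0 := by
    intro h0
    rw [h0, smul_zero] at hσ
    exact hσ rfl
  have := heig _ _ (Finset.prod_ne_zero_iff.1 hprod (σ⁻¹ j) (Finset.mem_univ _))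
  have hs : σ (σ⁻¹ j) = j := σ.apply_symm_apply j
  rw [hs] at this
  exact this

end Classification

end MoyalPlane

end

theorem mainTheorem4 (θ : ℝ) (hθ : 0 < θ) (q : ℕ) :
    -- the explicit operators are rank one fluxons, with the stated curvature and action
    (∀ l : Fin q → ℂ,
      MoyalPlane.IsFluxonWithCurvature θ q (MoyalPlane.fluxonD θ l) (MoyalPlane.fluxonDbar θ l)
        ((Complex.I / θ) • MoyalPlane.P q) ∧
      MoyalPlane.IsRankOne (MoyalPlane.fluxonD θ l) (MoyalPlane.fluxonDbar θ l)
        ((Complex.I / θ) • MoyalPlane.P q) ∧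
      MoyalPlane.IsVortexFrame (MoyalPlane.fluxonD θ l) ((Complex.I / θ) • MoyalPlane.P q)
        (fun i : Fin q => MoyalPlane.e i) ∧
      MoyalPlane.HasYMAction θ ((Complex.I / θ) • MoyalPlane.P q) (Real.pi * q / θ) ∧
      MoyalPlane.HasIntegral θ
        (-(((Complex.I / θ) • MoyalPlane.P q) * ((Complex.I / θ) • MoyalPlane.P q)))
        ((2 * Real.pi * q / θ : ℝ) : ℂ)) ∧
    -- distinct tuples give distinct fluxons
    Function.Injective (fun l : Fin q → ℂ =>
      (MoyalPlane.fluxonD θ l, MoyalPlane.fluxonDbar θ l)) ∧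
    -- two of them are gauge equivalent iff the tuples agree up to a permutation
    (∀ l m : Fin q → ℂ,
      MoyalPlane.GaugeEquiv (MoyalPlane.fluxonD θ l) (MoyalPlane.fluxonDbar θ l)
        (MoyalPlane.fluxonD θ m) (MoyalPlane.fluxonDbar θ m) ↔
      ∃ σ : Equiv.Perm (Fin q), m = l ∘ σ) ∧
    -- every rank one fluxon can be labelled; labelled ones correspond to exactly one tuple
    (∀ (D Dbar : MoyalPlane.Op) (F : MoyalPlane.BOp),
      MoyalPlane.IsFluxonWithCurvature θ q D Dbar F → MoyalPlane.IsRankOne D Dbar F →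
      (∃ u : Fin q → MoyalPlane.Fock, MoyalPlane.IsVortexFrame D F u) ∧
      ∀ u : Fin q → MoyalPlane.Fock, MoyalPlane.IsVortexFrame D F u →
        ∃! l : Fin q → ℂ, ∃ U : MoyalPlane.Fock ≃ₗᵢ[ℂ] MoyalPlane.Fock,
          (∀ i : Fin q, U (MoyalPlane.e i) = u i) ∧
          D = MoyalPlane.conjOp U (MoyalPlane.fluxonD θ l) ∧
          Dbar = MoyalPlane.conjOp U (MoyalPlane.fluxonDbar θ l)) ∧
    -- fluxons of arbitrary rank: `q` vortices and an orthogonal sum of copies of `(-c†, c)`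
    (∀ (D Dbar : MoyalPlane.Op) (F : MoyalPlane.BOp),
      MoyalPlane.IsFluxonWithCurvature θ q D Dbar F →
      MoyalPlane.HasYMAction θ F (Real.pi * q / θ) ∧
      ∃ (l : Fin q → ℂ) (u : Fin q → MoyalPlane.Fock) (ι : Type)
        (W : ι → MoyalPlane.Fock →ₗᵢ[ℂ] MoyalPlane.Fock),
        Nonempty ι ∧
        Orthonormal ℂ u ∧
        F = (Complex.I / θ) • ∑ i, MoyalPlane.proj (u i) ∧
        (∀ i, ∃ h : u i ∈ D.domain, D ⟨u i, h⟩ = l i • u i) ∧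
        (∀ i, ∃ h : u i ∈ Dbar.domain,
          Dbar ⟨u i, h⟩ = -(starRingEnd ℂ (l i)) • u i) ∧
        (∀ k k', k ≠ k' → ∀ v w, inner ℂ (W k v) (W k' w) = 0) ∧
        (∀ k i v, inner ℂ (u i) (W k v) = 0) ∧
        (Submodule.span ℂ (Set.range u) ⊔ ⨆ k, (W k).range).topologicalClosure = ⊤ ∧
        (∀ k, MoyalPlane.opMul D (MoyalPlane.ofBounded (W k).toContinuousLinearMap) =
          MoyalPlane.opMul (MoyalPlane.ofBounded (W k).toContinuousLinearMap)
            (-MoyalPlane.cDag θ)) ∧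
        (∀ k, MoyalPlane.opMul Dbar (MoyalPlane.ofBounded (W k).toContinuousLinearMap) =
          MoyalPlane.opMul (MoyalPlane.ofBounded (W k).toContinuousLinearMap)
            (MoyalPlane.c θ))) := by
  refine ⟨fun l => ⟨MoyalPlane.isFluxonWithCurvature_fluxon hθ l,
      MoyalPlane.isRankOne_fluxon hθ l, MoyalPlane.isVortexFrame_fluxon hθ l,
      MoyalPlane.hasYMAction_sum_proj hθ MoyalPlane.orthonormal_e_fin,
      MoyalPlane.hasIntegral_neg_sq hθ⟩,
    fun l m h => MoyalPlane.fluxonD_injective hθ (Prod.ext_iff.1 h).1,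
    fun l m => ⟨MoyalPlane.exists_perm_of_gaugeEquiv hθ, ?_⟩,
    fun D Dbar F h hr => ⟨h.exists_frame hθ, fun u hu => hu.existsUnique hθ h hr⟩,
    fun D Dbar F h => h.exists_decomposition hθ⟩
  rintro ⟨σ, rfl⟩
  exact MoyalPlane.gaugeEquiv_of_perm hθ l σ
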